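/- **Sorting under explorable uncertainty with predictions.** An instance consists of a finite set $V$ of $n$ vertices and, for each $v\in V$, an open uncertainty interval $I_v=(L_v,U_v)\subseteq\mathbb{R}$, a predicted weight $\overline{w}_v\in I_v$ and an initially unknown precise weight $w_v\in I_v$. Two distinct vertices $u,v$ form an edge if and only if $I_u\cap I_v\neq\emptyset$. Querying $v$ reveals $w_v$. A set $Q\subseteq V$ is *feasible* (for $w$) if querying $Q$ reveals enough information to orient every edge towards an endpoint of minimum precise weight, i.e. for every edge $\{u,v\}$ one of the inequalities $w'_u\le w'_v$, $w'_v\le w'_u$ holds for all weight vectors $w'$ with $w'_x\in I_x$ for all $x\in V$ and $w'_x=w_x$ for all $x\in Q$. Let $|\mathrm{OPT}|$ be the minimum size of a feasible set for $w$. A vertex is *mandatory* if it is in every feasible set; let $\mathcal I_R$ be the set of mandatory vertices for the precise weights $w$ and $\mathcal I_P$ the set of vertices that are mandatory when the precise weights are $\overline{w}$. The error measures are - $k_\# = |\{v\in V : w_v\ne\overline{w}_v\}|$, - $k_M = |(\mathcal I_P\setminus\mathcal I_R)\cup(\mathcal I_R\setminus\mathcal I_P)|$, - $k_h=\sum_{v\in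 V}\sum_{u\in V\setminus\{v\}}k_u(v)$, where $k_u(v)=1$ if $\overline{w}_v\le L_u<w_v$ or $w_v\le L_u<\overline{w}_v$ or $w_v<U_u\le\overline{w}_v$ or $\overline{w}_v<U_u\le w_v$, and $k_u(v)=0$ otherwise. An adaptive algorithm receives the $L_v$, $U_v$ and $\overline{w}_v$, and learns $w_v$ only by querying $v$. Algorithms are programs for a random access machine that may compare the accessible real numbers and may add, subtract and compare natural numbers, each at unit cost; a query also costs one step. **Theorem.** There is a single deterministic adaptive algorithm and a polynomial $p$ such that, on every instance with $n$ vertices, the algorithm halts after at most $p(n)$ steps, the set of queried vertices is feasible, and for every $k\in\{k_\#,k_M,k_h\}$ the number of queries that it makes is at most $$\min\Big\{1+\frac{k}{|\mathrm{OPT}|},\,2\Big\}\cdot|\mathrm{OPT}|$$ (which is read as $0$ if $|\mathrm{OPT}|=0$). In particular, the algorithm is $1$-consistent (it makes at most $|\mathrm{OPT}|$ queries if $w=\overline{w}$) and $2$-robust (it always makes at most $2|\mathrm{OPT}|$ queries). -/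

import Mathlib

/-! # Sorting under explorable uncertainty with predictions -/

namespace UncertainSorting

noncomputable section

/-- What the algorithm is given: `n` vertices, each with a (non-empty, open) uncertainty interval
`(lower v, upper v)` and a predicted weight `pred v` inside that interval. -/
structure Input (n : ℕ) where
  lower : Fin n → ℝ
  upper : Fin n → ℝ
  pred : Fin n → ℝ
  pred_mem : ∀ v, pred v ∈ Set.Ioo (lower v) (upper v)

variable {n : ℕ}

namespace Input

/-- The uncertainty interval `I_v` of a vertex. -/
def interval (I : Input n) (v : Fin n) : Set ℝ := Set.Ioo (I.lower v) (I.upper v)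

/-- `w` is a possible vector of precise weights. -/
def IsRealization (I : Input n) (w : Fin n → ℝ) : Prop := ∀ v, w v ∈ I.interval v

/-- The interval graph: the edges are the pairs of distinct vertices with intersecting intervals. -/
def graph (I : Input n) : SimpleGraph (Fin n) where
  Adj u v := u ≠ v ∧ (I.interval u ∩ I.interval v).Nonempty
  symm := ⟨fun _ _ h => ⟨h.1.symm, by rw [Set.inter_comm]; exact h.2⟩⟩
  loopless := ⟨fun _ h => h.1 rfl⟩

/-- If the precise weights are `w` and the vertices in `Q` have been queried, then `w'` is a vector
of precise weights that is compatible with all the information obtained. -/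
def Compatible (I : Input n) (w : Fin n → ℝ) (Q : Finset (Fin n)) (w' : Fin n → ℝ) : Prop :=
  I.IsRealization w' ∧ ∀ v ∈ Q, w' v = w v

/-- `Q` is a feasible query set for the precise weights `w`: querying `Q` reveals sufficient
information to orient every edge towards an endpoint of minimum precise weight. -/
def Feasible (I : Input n) (w : Fin n → ℝ) (Q : Finset (Fin n)) : Prop :=
  ∀ u v, I.graph.Adj u v →
    (∀ w', I.Compatible w Q w' → w' u ≤ w' v) ∨ (∀ w', I.Compatible w Q w' → w' v ≤ w' u)

/-- Querying everything is feasible, so the infimum in the definition of `opt` is attained. -/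
theorem feasible_univ (I : Input n) (w : Fin n → ℝ) : I.Feasible w Finset.univ := by
  intro u v _
  rcases le_total (w u) (w v) with h | h
  · left
    intro w' hw
    rw [hw.2 u (Finset.mem_univ u), hw.2 v (Finset.mem_univ v)]
    exact h
  · right
    intro w' hw
    rw [hw.2 u (Finset.mem_univ u), hw.2 v (Finset.mem_univ v)]
    exact h

/-- `|OPT|`: the minimum size of a feasible query set for the precise weights `w`. -/
def opt (I : Input n) (w : Fin n → ℝ) : ℕ :=
  sInf {m | ∃ Q : Finset (Fin n), I.Feasible w Q ∧ Q.card = m}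

/-- The mandatory vertices for the precise weights `w`: those in every feasible query set. The
prediction mandatory vertices are `I.mandatory I.pred`. -/
def mandatory (I : Input n) (w : Fin n → ℝ) : Set (Fin n) :=
  {v | ∀ Q, I.Feasible w Q → v ∈ Q}

/-- `k_#`: the number of inaccurate predictions. -/
def errCount (I : Input n) (w : Fin n → ℝ) : ℕ := {v | w v ≠ I.pred v}.ncard

/-- `k_M`: the mandatory query distance. -/
def errMandatory (I : Input n) (w : Fin n → ℝ) : ℕ :=
  (symmDiff (I.mandatory I.pred) (I.mandatory w)).ncard

/-- `k_u(v) = 1`: the weight of `v` passes over an endpoint of `I_u` when going from its predicted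
to its precise value. -/
def Hops (I : Input n) (w : Fin n → ℝ) (u v : Fin n) : Prop :=
  (I.pred v ≤ I.lower u ∧ I.lower u < w v) ∨ (w v ≤ I.lower u ∧ I.lower u < I.pred v) ∨
  (w v < I.upper u ∧ I.upper u ≤ I.pred v) ∨ (I.pred v < I.upper u ∧ I.upper u ≤ w v)

open Classical in
/-- `k_h`: the hop distance. -/
def errHop (I : Input n) (w : Fin n → ℝ) : ℕ :=
  ∑ v : Fin n, ∑ u ∈ Finset.univ.erase v, if I.Hops w u v then 1 else 0

end Input

/-! ## The machine model

Adaptive query algorithms are programs of a small imperative language, executed on a random access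
machine with a memory of natural numbers addressed by pairs `(i, j)`. A program is one finite
object, used for all `n`. Real numbers can only be compared, and the precise weight of a vertex is
accessible only after that vertex has been queried. -/

/-- Expressions for natural numbers: constants, the number `n` of vertices, a memory cell, sum, and
truncated difference. -/
inductive NatExpr
  | const (k : ℕ)
  | size
  | cell (i j : NatExpr)
  | add (a b : NatExpr)
  | sub (a b : NatExpr)

/-- Expressions for the accessible real numbers: lower limit, upper limit, predicted weight, and
precise weight of the vertex whose number is given. -/
inductive RealExpr
  | lower (e : NatExpr)
  | upper (e : NatExpr)
  | pred (e : NatExpr)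
  | weight (e : NatExpr)

/-- Tests: comparison of naturals, comparison of reals, and boolean combinations. -/
inductive Test
  | natLe (a b : NatExpr)
  | realLe (x y : RealExpr)
  | neg (b : Test)
  | both (b c : Test)

/-- Programs. -/
inductive Program
  | nop
  /-- Write the value of `e` into the memory cell `(i, j)`. -/
  | assign (i j e : NatExpr)
  /-- Query the vertex whose number is the value of `e`. -/
  | query (e : NatExpr)
  | seq (p q : Program)
  | cond (b : Test) (p q : Program)
  | loop (b : Test) (p : Program)

/-- The state of a computation: the memory, and the list of all queries made so far, most recent
first and with repetitions. -/
structure State (n : ℕ) where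
  mem : ℕ → ℕ → ℕ
  queries : List (Fin n)

/-- The initial state: memory zero, no queries. -/
def State.init (n : ℕ) : State n := ⟨fun _ _ => 0, []⟩

def NatExpr.eval (s : State n) : NatExpr → ℕ
  | const k => k
  | size => n
  | cell i j => s.mem (i.eval s) (j.eval s)
  | add a b => a.eval s + b.eval s
  | sub a b => a.eval s - b.eval s

open Classical in
/-- The value is `0` if the number is not that of a vertex, and the precise weight of a vertex
reads as `0` as long as that vertex has not been queried. -/
def RealExpr.eval (I : Input n) (w : Fin n → ℝ) (s : State n) : RealExpr → ℝ
  | lower e => if h : e.eval s < n then I.lower ⟨e.eval s, h⟩ else 0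
  | upper e => if h : e.eval s < n then I.upper ⟨e.eval s, h⟩ else 0
  | pred e => if h : e.eval s < n then I.pred ⟨e.eval s, h⟩ else 0
  | weight e =>
      if h : e.eval s < n then
        if (⟨e.eval s, h⟩ : Fin n) ∈ s.queries then w ⟨e.eval s, h⟩ else 0
      else 0

def Test.Holds (I : Input n) (w : Fin n → ℝ) (s : State n) : Test → Prop
  | natLe a b => a.eval s ≤ b.eval s
  | realLe x y => x.eval I w s ≤ y.eval I w s
  | neg b => ¬ b.Holds I w s
  | both b c => b.Holds I w s ∧ c.Holds I w s

/-- Effect of an assignment. -/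
def State.write (s : State n) (i j k : ℕ) : State n :=
  { s with mem := Function.update s.mem i (Function.update (s.mem i) j k) }

/-- Effect of a query; nothing happens if the number is not that of a vertex. -/
def State.ask (s : State n) (v : ℕ) : State n :=
  if h : v < n then { s with queries := ⟨v, h⟩ :: s.queries } else s

/-- `Exec I w p s t s'`: on input `I` with (hidden) precise weights `w`, the program `p`, started in
the state `s`, halts after exactly `t` steps in the state `s'`. Every elementary command and every
evaluation of the test of a branch or a loop is one step; the expressions that occur in
a fixed program have bounded size. -/
inductive Exec (I : Input n) (w : Fin n → ℝ) : Program → State n → ℕ → State n → Prop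
  | nop (s : State n) : Exec I w Program.nop s 1 s
  | assign (i j e : NatExpr) (s : State n) :
      Exec I w (Program.assign i j e) s 1 (s.write (i.eval s) (j.eval s) (e.eval s))
  | query (e : NatExpr) (s : State n) : Exec I w (Program.query e) s 1 (s.ask (e.eval s))
  | seq {p q : Program} {s s₁ s₂ : State n} {t₁ t₂ : ℕ} :
      Exec I w p s t₁ s₁ → Exec I w q s₁ t₂ s₂ → Exec I w (Program.seq p q) s (t₁ + t₂) s₂
  | condTrue {b : Test} {p q : Program} {s s₁ : State n} {t : ℕ} :
      b.Holds I w s → Exec I w p s t s₁ → Exec I w (Program.cond b p q) s (1 + t) s₁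
  | condFalse {b : Test} {p q : Program} {s s₁ : State n} {t : ℕ} :
      ¬ b.Holds I w s → Exec I w q s t s₁ → Exec I w (Program.cond b p q) s (1 + t) s₁
  | loopStop {b : Test} {p : Program} {s : State n} :
      ¬ b.Holds I w s → Exec I w (Program.loop b p) s 1 s
  | loopStep {b : Test} {p : Program} {s s₁ s₂ : State n} {t₁ t₂ : ℕ} :
      b.Holds I w s → Exec I w p s t₁ s₁ → Exec I w (Program.loop b p) s₁ t₂ s₂ →
      Exec I w (Program.loop b p) s (1 + t₁ + t₂) s₂

/-- The execution is deterministic. -/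
theorem Exec.det {I : Input n} {w : Fin n → ℝ} {p : Program} {s s₁ : State n} {t₁ : ℕ}
    (h₁ : Exec I w p s t₁ s₁) :
    ∀ {t₂ : ℕ} {s₂ : State n}, Exec I w p s t₂ s₂ → t₁ = t₂ ∧ s₁ = s₂ := by
  induction h₁ with
  | nop s => intro t₂ s₂ h; cases h; exact ⟨rfl, rfl⟩
  | assign i j e s => intro t₂ s₂ h; cases h; exact ⟨rfl, rfl⟩
  | query e s => intro t₂ s₂ h; cases h; exact ⟨rfl, rfl⟩
  | seq _ _ ih₁ ih₂ =>
    intro t₂ s₂ h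
    cases h with
    | seq h₁ h₂ =>
      obtain ⟨rfl, rfl⟩ := ih₁ h₁
      obtain ⟨rfl, rfl⟩ := ih₂ h₂
      exact ⟨rfl, rfl⟩
  | condTrue hb _ ih =>
    intro t₂ s₂ h
    cases h with
    | condTrue _ h => obtain ⟨rfl, rfl⟩ := ih h; exact ⟨rfl, rfl⟩
    | condFalse hb' _ => exact absurd hb hb'
  | condFalse hb _ ih =>
    intro t₂ s₂ h
    cases h with
    | condTrue hb' _ => exact absurd hb' hb
    | condFalse _ h => obtain ⟨rfl, rfl⟩ := ih h; exact ⟨rfl, rfl⟩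
  | loopStop hb =>
    intro t₂ s₂ h
    cases h with
    | loopStop _ => exact ⟨rfl, rfl⟩
    | loopStep hb' _ _ => exact absurd hb' hb
  | loopStep hb _ _ ih₁ ih₂ =>
    intro t₂ s₂ h
    cases h with
    | loopStop hb' => exact absurd hb hb'
    | loopStep _ h₁ h₂ =>
      obtain ⟨rfl, rfl⟩ := ih₁ h₁
      obtain ⟨rfl, rfl⟩ := ih₂ h₂
      exact ⟨rfl, rfl⟩

end

end UncertainSorting

/-! By `feasible_iff`, a set is feasible exactly if it is a vertex cover of the interval graph that
contains every vertex whose interval contains the weight of another vertex (a forced vertex). The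
algorithm queries the prediction mandatory vertices and closes under forcing by revealed weights;
this gives `D`. Outside `D` no interval contains another one and no three meet pairwise
(`no_triangle`), so the remaining graph is a disjoint union of paths. A minimum cover `C` of these
paths is queried, followed by a second closure, which adds a set `E` of forced vertices. All queries
together form `A`, the union of `D`, `C` and `E`.

Error bounds: let `O` be an optimal feasible set. Matching each vertex of `C` with a path neighbour
outside `C` gives `|C| ≤ |O \ D|`, hence `|A| ≤ |O| + |D \ O| + |E|`. Vertices of `D \ O` are
prediction mandatory but not mandatory, those of `E` the reverse, so `k_M` bounds the excess; and
`k_M ≤ k_h`, because a wrong status of `v` needs a weight that crosses an endpoint of `I_v`. For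
`k_#`, each vertex of `D \ O` and of `E` has a wrongly predicted vertex as its cause. One vertex
causes at most one of each kind, and if it causes both, then it and its matching partner both lie in
`O` (`partner_mem`), which pays for the double count.

Robustness: the non-nested vertices form chains under `prev`, the left neighbour with greatest lower
limit. Consecutive vertices are adjacent, so `O` contains half of each chain, rounded down. A chain
has deficit one only if `O` consists of exactly its even positions (`excess_bounds`). Such a chain
either has an unqueried vertex or can be charged to a nested vertex that pays for no other chain;
nested vertices lie in `O` and have a surplus of one each. This is where the choice of the minimum
cover matters: a path outside `D` omits its left end if that end has an odd position in its chain,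
and its right end otherwise (`mem_D_of_alternating`). -/

namespace UncertainSorting

variable {n : ℕ}

namespace Input

variable {I : Input n} {w : Fin n → ℝ}

/-! ### Feasible sets as vertex covers with forced vertices -/

/-- The weight `w u` lies in the interval of another vertex `v`; hence `v` is mandatory for `w`. -/
def Forces (I : Input n) (w : Fin n → ℝ) (u v : Fin n) : Prop :=
  u ≠ v ∧ I.lower v < w u ∧ w u < I.upper v

/-- `v` is mandatory for the predicted weights. -/
def Predicted (I : Input n) (v : Fin n) : Prop := ∃ u, I.Forces I.pred u v

/-- The interval of `v` contains the interval of another vertex. -/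
def Nested (I : Input n) (v : Fin n) : Prop :=
  ∃ u, u ≠ v ∧ I.lower v ≤ I.lower u ∧ I.upper u ≤ I.upper v

/-- The left endpoint of the interval of `v` lies in the interval of `u`. -/
def LeftOf (I : Input n) (u v : Fin n) : Prop :=
  I.lower u < I.lower v ∧ I.lower v < I.upper u

theorem lower_lt_upper (I : Input n) (v : Fin n) : I.lower v < I.upper v :=
  (I.pred_mem v).1.trans (I.pred_mem v).2

theorem isRealization_pred (I : Input n) : I.IsRealization I.pred := I.pred_mem

theorem adj_iff {u v : Fin n} :
    I.graph.Adj u v ↔ u ≠ v ∧ I.lower u < I.upper v ∧ I.lower v < I.upper u := by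
  constructor
  · rintro ⟨hne, x, hu, hv⟩
    exact ⟨hne, hu.1.trans hv.2, hv.1.trans hu.2⟩
  · rintro ⟨hne, h1, h2⟩
    refine ⟨hne, ?_⟩
    have hu := I.lower_lt_upper u
    have hv := I.lower_lt_upper v
    obtain ⟨x, hx1, hx2⟩ := exists_between
      (show max (I.lower u) (I.lower v) < min (I.upper u) (I.upper v) by
        rw [max_lt_iff, lt_min_iff, lt_min_iff]; exact ⟨⟨hu, h1⟩, h2, hv⟩)
    rw [max_lt_iff] at hx1
    rw [lt_min_iff] at hx2
    exact ⟨x, ⟨hx1.1, hx2.1⟩, hx1.2, hx2.2⟩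

theorem Forces.adj (hw : I.IsRealization w) {u v : Fin n} (h : I.Forces w u v) :
    I.graph.Adj u v :=
  ⟨h.1, w u, hw u, h.2⟩

theorem LeftOf.adj {u v : Fin n} (h : I.LeftOf u v) : I.graph.Adj u v := by
  rw [adj_iff]
  refine ⟨fun e => (h.1.ne (by rw [e])), h.1.trans (I.lower_lt_upper v), h.2⟩

/-- A common point of two intervals that is consistent with the queries in `Q` leaves the order of
the weights open unless the second vertex is queried. -/
theorem Feasible.mem_of_common (hw : I.IsRealization w) {Q : Finset (Fin n)} (hQ : I.Feasible w Q)
    {u v : Fin n} (hne : u ≠ v) {z : ℝ} (hu : z ∈ I.interval u) (hv : z ∈ I.interval v)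
    (hz : u ∈ Q → z = w u) : v ∈ Q := by
  by_contra hvQ
  have key : ∀ y ∈ I.interval v,
      I.Compatible w Q (Function.update (Function.update w u z) v y) := by
    intro y hy
    constructor
    · intro x
      by_cases hxv : x = v
      · subst hxv; simpa using hy
      · by_cases hxu : x = u
        · subst hxu; simpa [hxv] using hu
        · simpa [hxv, hxu] using hw x
    · intro x hx
      have hxv : x ≠ v := fun e => hvQ (e ▸ hx)
      by_cases hxu : x = u
      · subst hxu; simpa [hxv] using hz hx
      · simp [hxv, hxu]
  -- An unqueried `v` may have a weight on either side of `z`, so each of the two orientations is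
  -- refuted by one choice.
  obtain ⟨a, ha1, ha2⟩ := exists_between hv.1
  obtain ⟨b, hb1, hb2⟩ := exists_between hv.2
  rcases hQ u v ⟨hne, z, hu, hv⟩ with h | h
  · have := h _ (key a ⟨ha1, ha2.trans hv.2⟩)
    simp [hne] at this
    linarith
  · have := h _ (key b ⟨hv.1.trans hb1, hb2⟩)
    simp [hne] at this
    linarith

/-- The feasible query sets are the vertex covers that contain every forced vertex. -/
theorem feasible_iff (hw : I.IsRealization w) {Q : Finset (Fin n)} :
    I.Feasible w Q ↔ (∀ u v, I.graph.Adj u v → u ∈ Q ∨ v ∈ Q) ∧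
      ∀ u v, I.Forces w u v → v ∈ Q := by
  constructor
  · intro hQ
    refine ⟨fun u v huv => ?_, fun u v h => ?_⟩
    · by_cases hu : u ∈ Q
      · exact Or.inl hu
      · obtain ⟨hne, z, hzu, hzv⟩ := huv
        exact Or.inr (hQ.mem_of_common hw hne hzu hzv fun h => absurd h hu)
    · exact hQ.mem_of_common hw h.1 (hw u) h.2 fun _ => rfl
  · rintro ⟨hcov, hforce⟩
    have one : ∀ u v, I.graph.Adj u v → u ∈ Q →
        (∀ w', I.Compatible w Q w' → w' u ≤ w' v) ∨
          (∀ w', I.Compatible w Q w' → w' v ≤ w' u) := by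
      intro u v huv hu
      by_cases hv : v ∈ Q
      · rcases le_total (w u) (w v) with h | h
        · left; intro w' hw'; rw [hw'.2 u hu, hw'.2 v hv]; exact h
        · right; intro w' hw'; rw [hw'.2 u hu, hw'.2 v hv]; exact h
      · have hnot : ¬ I.Forces w u v := fun h => hv (hforce u v h)
        -- As `w u` lies outside `I_v`, the revealed weight is on one side of the whole interval,
        -- which decides the edge.
        have hnot' : I.lower v < w u → I.upper v ≤ w u := by
          intro h1
          by_contra h2
          exact hnot ⟨huv.1, h1, not_le.mp h2⟩
        rcases le_or_gt (w u) (I.lower v) with h | h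
        · left; intro w' hw'; rw [hw'.2 u hu]; exact h.trans (hw'.1 v).1.le
        · right; intro w' hw'; rw [hw'.2 u hu]; exact (hw'.1 v).2.le.trans (hnot' h)
    intro u v huv
    rcases hcov u v huv with h | h
    · exact one u v huv h
    · exact (one v u huv.symm h).symm

/-- If nothing forces `v`, then all other vertices together are feasible: they cover every edge and
contain every forced vertex. -/
theorem mem_mandatory_iff (hw : I.IsRealization w) {v : Fin n} :
    v ∈ I.mandatory w ↔ ∃ u, I.Forces w u v := by
  constructor
  · intro hv
    by_contra hno
    push Not at hno
    have hfeas : I.Feasible w (Finset.univ.erase v) := by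
      rw [feasible_iff hw]
      refine ⟨fun a b hab => ?_, fun a b hab => ?_⟩
      · by_cases ha : a = v
        · right; simpa using fun e => hab.1 (ha.trans e.symm)
        · left; simpa using ha
      · exact Finset.mem_erase.mpr ⟨fun e => hno a (e ▸ hab), Finset.mem_univ _⟩
    simpa using hv _ hfeas
  · rintro ⟨u, hu⟩ Q hQ
    exact ((feasible_iff hw).mp hQ).2 u v hu

theorem exists_feasible_card_eq_opt (I : Input n) (w : Fin n → ℝ) :
    ∃ Q, I.Feasible w Q ∧ Q.card = I.opt w :=
  Nat.sInf_mem (s := {m | ∃ Q : Finset (Fin n), I.Feasible w Q ∧ Q.card = m})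
    ⟨_, Finset.univ, I.feasible_univ w, rfl⟩

/-! ### Geometry of intervals without nesting -/

/-- The weight of the inner vertex lies in the outer interval whatever its value. Hence nested
vertices are mandatory for the predicted and for the precise weights. -/
theorem Nested.forced (hw : I.IsRealization w) {v : Fin n} (h : I.Nested v) :
    ∃ u, I.Forces w u v := by
  obtain ⟨u, hne, h1, h2⟩ := h
  exact ⟨u, hne, h1.trans_lt (hw u).1, (hw u).2.trans_le h2⟩

theorem not_nested_of_not_predicted {v : Fin n} (h : ¬ I.Predicted v) : ¬ I.Nested v :=
  fun hn => h (hn.forced I.isRealization_pred)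

theorem lower_upper_lt {u v : Fin n} (hu : ¬ I.Nested u) (hv : ¬ I.Nested v) (hne : u ≠ v) :
    (I.lower u < I.lower v ∧ I.upper u < I.upper v) ∨
      (I.lower v < I.lower u ∧ I.upper v < I.upper u) := by
  have h1 : I.lower u ≤ I.lower v → I.upper u < I.upper v := fun h => by
    by_contra h'
    exact hu ⟨v, hne.symm, h, not_lt.mp h'⟩
  have h2 : I.lower v ≤ I.lower u → I.upper v < I.upper u := fun h => by
    by_contra h'
    exact hv ⟨u, hne, h, not_lt.mp h'⟩
  rcases lt_trichotomy (I.lower u) (I.lower v) with h | h | h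
  · exact Or.inl ⟨h, h1 h.le⟩
  · exact absurd (h1 h.le) (h2 h.ge).not_gt
  · exact Or.inr ⟨h, h2 h.le⟩

theorem upper_lt_of_lower_lt {u v : Fin n} (hu : ¬ I.Nested u) (h : I.lower u < I.lower v) :
    I.upper u < I.upper v := by
  by_contra h'
  exact hu ⟨v, fun e => h.ne (by rw [e]), h.le, not_lt.mp h'⟩

theorem leftOf_or_leftOf {u v : Fin n} (hu : ¬ I.Nested u) (hv : ¬ I.Nested v)
    (h : I.graph.Adj u v) : I.LeftOf u v ∨ I.LeftOf v u := by
  rw [adj_iff] at h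
  rcases lower_upper_lt hu hv h.1 with h' | h'
  · exact Or.inl ⟨h'.1, h.2.2⟩
  · exact Or.inr ⟨h'.1, h.2.1⟩

/-- Three pairwise intersecting intervals cannot all be outside the predicted set. -/
theorem no_triangle {x y z : Fin n} (hx : ¬ I.Predicted x) (hy : ¬ I.Predicted y)
    (hz : ¬ I.Predicted z) (hxy : I.lower x < I.lower y) (hyz : I.lower y < I.lower z)
    (hxz : I.lower z < I.upper x) : False := by
  have huyz := upper_lt_of_lower_lt (not_nested_of_not_predicted hy) hyz
  -- The middle interval is covered by the two outer ones, so its predicted weight forces one of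
  -- them.
  have hp := I.pred_mem y
  rcases lt_or_ge (I.pred y) (I.upper x) with h | h
  · exact hx ⟨y, fun e => hxy.ne (by rw [e]), hxy.trans hp.1, h⟩
  · exact hz ⟨y, fun e => hyz.ne (by rw [e]), hxz.trans_le h, hp.2.trans huyz⟩

/-- Two left neighbours of `z` share the point `lower z`, so with `z` they would form a triangle.
Together with the mirror image this shows that the graph outside the predicted set is a union of
paths. -/
theorem leftOf_left_unique {x y z : Fin n} (hx : ¬ I.Predicted x) (hy : ¬ I.Predicted y)
    (hz : ¬ I.Predicted z) (h1 : I.LeftOf x z) (h2 : I.LeftOf y z) : x = y := by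
  by_contra hne
  rcases lower_upper_lt (not_nested_of_not_predicted hx) (not_nested_of_not_predicted hy) hne
    with h | h
  · exact no_triangle hx hy hz h.1 h2.1 h1.2
  · exact no_triangle hy hx hz h.1 h1.1 h2.2

theorem leftOf_right_unique {x y z : Fin n} (hx : ¬ I.Predicted x) (hy : ¬ I.Predicted y)
    (hz : ¬ I.Predicted z) (h1 : I.LeftOf z x) (h2 : I.LeftOf z y) : x = y := by
  by_contra hne
  rcases lower_upper_lt (not_nested_of_not_predicted hx) (not_nested_of_not_predicted hy) hne
    with h | h
  · exact no_triangle hz hx hy h1.1 h.1 h2.2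
  · exact no_triangle hz hy hx h2.1 h.1 h1.2

/-- The vertices whose intervals contain a common weight are pairwise adjacent, so at most one
of them is outside a vertex cover. -/
theorem eq_of_forces {p : Fin n → ℝ} {Q : Finset (Fin n)}
    (hcov : ∀ u v, I.graph.Adj u v → u ∈ Q ∨ v ∈ Q) {u a b : Fin n} (ha : I.Forces p u a)
    (hb : I.Forces p u b) (haQ : a ∉ Q) (hbQ : b ∉ Q) : a = b := by
  by_contra hne
  rcases hcov a b ⟨hne, p u, ha.2, hb.2⟩ with h | h
  · exact haQ h
  · exact hbQ h

theorem lower_induction (I : Input n) {p : Fin n → Prop}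
    (h : ∀ a, (∀ b, I.lower b < I.lower a → p b) → p a) (a : Fin n) : p a := by
  have wf : WellFounded (fun b a : Fin n => I.lower b < I.lower a) := by
    have : IsTrans (Fin n) (fun b a : Fin n => I.lower b < I.lower a) :=
      ⟨fun _ _ _ h1 h2 => lt_trans h1 h2⟩
    have : Std.Irrefl (fun b a : Fin n => I.lower b < I.lower a) := ⟨fun _ => lt_irrefl _⟩
    exact Finite.wellFounded_of_trans_of_irrefl _
  exact wf.induction a h

end Input

variable {I : Input n} {w : Fin n → ℝ}

/-! ### Recursion along pointers -/

/-- The number of vertices with smaller lower limit. -/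
noncomputable def Input.rank (I : Input n) (a : Fin n) : ℕ :=
  Set.ncard {b | I.lower b < I.lower a}

/-- The number of vertices with greater lower limit. -/
noncomputable def Input.corank (I : Input n) (a : Fin n) : ℕ :=
  Set.ncard {b | I.lower a < I.lower b}

theorem Input.rank_lt_rank {a b : Fin n} (h : I.lower b < I.lower a) : I.rank b < I.rank a :=
  Set.ncard_lt_ncard ⟨fun _ hc => lt_trans hc h, fun hs => by simpa using hs h⟩ (Set.toFinite _)

theorem Input.corank_lt_corank {a b : Fin n} (h : I.lower a < I.lower b) :
    I.corank b < I.corank a :=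
  Set.ncard_lt_ncard ⟨fun _ hc => lt_trans h hc, fun hs => by simpa using hs h⟩ (Set.toFinite _)

theorem Input.rank_lt (a : Fin n) : I.rank a < n := by
  have : I.rank a < (Set.univ : Set (Fin n)).ncard :=
    Set.ncard_lt_ncard ⟨Set.subset_univ _, fun hs => by simpa using hs (Set.mem_univ a)⟩
      (Set.toFinite _)
  simpa [Set.ncard_univ] using this

theorem Input.corank_lt (a : Fin n) : I.corank a < n := by
  have : I.corank a < (Set.univ : Set (Fin n)).ncard :=
    Set.ncard_lt_ncard ⟨Set.subset_univ _, fun hs => by simpa using hs (Set.mem_univ a)⟩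
      (Set.toFinite _)
  simpa [Set.ncard_univ] using this

/-- `ptr a` is a vertex with greatest lower limit among the `b` with `K a b`, if there is one. -/
def Input.IsMaxPtr (I : Input n) (K : Fin n → Fin n → Prop) (ptr : Fin n → Option (Fin n)) :
    Prop :=
  ∀ a, (ptr a = none → ∀ b, ¬ K a b) ∧
    ∀ b, ptr a = some b → K a b ∧ ∀ b', K a b' → I.lower b' ≤ I.lower b

/-- `f` is obtained by propagation along the pointers `ptr`, with given initial values. -/
def IsPropagation (ptr : Fin n → Option (Fin n)) (base : Fin n → ℕ) (op : ℕ → ℕ)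
    (f : Fin n → ℕ) : Prop :=
  ∀ a, f a = (ptr a).elim (base a) (fun b => op (f b))

/-- Pointers decrease the rank, so a function that satisfies the equation below rank `k` can be
corrected at rank `k` without disturbing smaller ranks. -/
theorem exists_recursive {β : Type*} (ptr : Fin n → Option (Fin n)) (rk : Fin n → ℕ)
    (hrk : ∀ a b, ptr a = some b → rk b < rk a) (G : Fin n → Option β → β) :
    ∃ f : Fin n → β, ∀ a, f a = G a ((ptr a).map f) := by
  have : ∀ k, ∃ f : Fin n → β, ∀ a, rk a < k → f a = G a ((ptr a).map f) := by
    intro k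
    induction k with
    | zero => exact ⟨fun a => G a none, fun a h => absurd h (Nat.not_lt_zero _)⟩
    | succ k ih =>
      obtain ⟨f, hf⟩ := ih
      refine ⟨fun a => if rk a < k then f a else G a ((ptr a).map f), fun a ha => ?_⟩
      have hmap : (ptr a).map (fun a => if rk a < k then f a else G a ((ptr a).map f)) =
          (ptr a).map f := by
        cases hp : ptr a with
        | none => rfl
        | some b =>
          have := hrk a b hp
          simp [show rk b < k by omega]
      simp only
      rw [hmap]
      split_ifs with h
      · exact hf a h
      · rfl
  obtain ⟨f, hf⟩ := this (Finset.univ.sup rk + 1)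
  exact ⟨f, fun a => hf a (Nat.lt_succ_of_le (Finset.le_sup (Finset.mem_univ a)))⟩

/-! ### Labels and the vertex cover outside `D` -/

/-- Exchanges `0` and `1` and fixes `2`. -/
def flip (v : ℕ) : ℕ := (1 - v) + ((v - 1) + (v - 1))

/-- The information collected by the algorithm: the set `D` queried in the first phase, the set `A`
of all queried vertices, and the labels that determine the vertex cover queried in between. -/
structure Plan (I : Input n) (w : Fin n → ℝ) where
  D : Finset (Fin n)
  A : Finset (Fin n)
  prev : Fin n → Option (Fin n)
  left : Fin n → Option (Fin n)
  right : Fin n → Option (Fin n)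
  par : Fin n → ℕ
  g : Fin n → ℕ
  h : Fin n → ℕ
  predicted_mem : ∀ v, I.Predicted v → v ∈ D
  mem_D : ∀ v ∈ D, I.Predicted v ∨ ∃ u, I.Forces w u v
  closed_D : ∀ u ∈ D, ∀ v, I.Forces w u v → v ∈ D
  prev_spec : I.IsMaxPtr (fun a b => ¬ I.Nested a ∧ ¬ I.Nested b ∧ I.LeftOf b a) prev
  left_spec : I.IsMaxPtr (fun a b => a ∉ D ∧ b ∉ D ∧ I.LeftOf b a) left
  right_spec : I.IsMaxPtr (fun a b => a ∉ D ∧ b ∉ D ∧ I.LeftOf a b) right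
  par_spec : IsPropagation prev (fun _ => 0) (fun v => 2 - v) par
  g_spec : IsPropagation left par flip g
  h_spec : IsPropagation right (fun _ => 0) (fun v => 1 - v) h
  D_sub : D ⊆ A
  cover_sub : ∀ v, v ∉ D → (g v = 1 ∨ g v = 2 ∧ h v = 1) → v ∈ A
  mem_A : ∀ v ∈ A, v ∈ D ∨ (g v = 1 ∨ g v = 2 ∧ h v = 1) ∨ ∃ u, I.Forces w u v
  closed_A : ∀ u ∈ A, ∀ v, I.Forces w u v → v ∈ A

namespace Plan

variable (π : Plan I w)

/-- The vertices chosen for the cover. -/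
def Chosen (v : Fin n) : Prop := v ∉ π.D ∧ (π.g v = 1 ∨ π.g v = 2 ∧ π.h v = 1)

theorem not_predicted {v : Fin n} (hv : v ∉ π.D) : ¬ I.Predicted v :=
  fun h => hv (π.predicted_mem v h)

theorem not_nested {v : Fin n} (hv : v ∉ π.D) : ¬ I.Nested v :=
  Input.not_nested_of_not_predicted (π.not_predicted hv)

theorem left_eq {x y : Fin n} (hx : x ∉ π.D) (hy : y ∉ π.D) (h : I.LeftOf x y) :
    π.left y = some x := by
  cases hl : π.left y with
  | none => exact absurd ⟨hy, hx, h⟩ ((π.left_spec y).1 hl x)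
  | some z =>
    obtain ⟨⟨_, hz, h'⟩, _⟩ := (π.left_spec y).2 z hl
    rw [Input.leftOf_left_unique (π.not_predicted hx) (π.not_predicted hz) (π.not_predicted hy) h h']

theorem right_eq {x y : Fin n} (hx : x ∉ π.D) (hy : y ∉ π.D) (h : I.LeftOf x y) :
    π.right x = some y := by
  cases hl : π.right x with
  | none => exact absurd ⟨hx, hy, h⟩ ((π.right_spec x).1 hl y)
  | some z =>
    obtain ⟨⟨_, hz, h'⟩, _⟩ := (π.right_spec x).2 z hl
    rw [Input.leftOf_right_unique (π.not_predicted hy) (π.not_predicted hz) (π.not_predicted hx) h h']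

theorem g_right {x y : Fin n} (hx : x ∉ π.D) (hy : y ∉ π.D) (h : I.LeftOf x y) :
    π.g y = flip (π.g x) := by
  rw [π.g_spec y, π.left_eq hx hy h]; rfl

theorem h_left {x y : Fin n} (hx : x ∉ π.D) (hy : y ∉ π.D) (h : I.LeftOf x y) :
    π.h x = 1 - π.h y := by
  rw [π.h_spec x, π.right_eq hx hy h]; rfl

/-- `par` records the parity of the position in a chain: `0` at odd positions, starting with the
first vertex, and `2` at even ones. These values let it serve directly as the initial value of `g`.
-/
theorem par_cases (v : Fin n) : π.par v = 0 ∨ π.par v = 2 := by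
  induction v using I.lower_induction with
  | h a ih =>
    rw [π.par_spec a]
    cases hp : π.prev a with
    | none => exact Or.inl rfl
    | some b =>
      rcases ih b ((π.prev_spec a).2 b hp).1.2.2.1 with h | h <;> simp [h]

/-- A path whose left end has `par = 0` is labelled `0, 1, 0, 1, …` by `g`; one whose left end has
`par = 2` is labelled `2` throughout, and there `h`, which alternates from the right end, decides.
-/
theorem g_cases (v : Fin n) : π.g v = 0 ∨ π.g v = 1 ∨ π.g v = 2 := by
  induction v using I.lower_induction with
  | h a ih =>
    rw [π.g_spec a]
    cases hp : π.left a with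
    | none => rcases π.par_cases a with h | h <;> simp [h]
    | some b =>
      rcases ih b ((π.left_spec a).2 b hp).1.2.2.1 with h | h | h <;> simp [h, flip]

theorem h_le (v : Fin n) : π.h v ≤ 1 := by
  rw [π.h_spec v]
  cases π.right v <;> simp

/-- Of two neighbours outside `D` exactly one is chosen. -/
theorem chosen_iff_not {x y : Fin n} (hx : x ∉ π.D) (hy : y ∉ π.D) (h : I.LeftOf x y) :
    π.Chosen x ↔ ¬ π.Chosen y := by
  have h1 := π.g_right hx hy h
  have h2 := π.h_left hx hy h
  have h3 := π.h_le y
  unfold Chosen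
  rcases π.g_cases x with h4 | h4 | h4 <;> rw [h4] at h1 <;> simp [flip] at h1 <;>
    simp [hx, hy, h1, h4]
  omega

theorem chosen_or_chosen {x y : Fin n} (hx : x ∉ π.D) (hy : y ∉ π.D) (h : I.graph.Adj x y) :
    (π.Chosen x ∧ ¬ π.Chosen y) ∨ (π.Chosen y ∧ ¬ π.Chosen x) := by
  rcases Input.leftOf_or_leftOf (π.not_nested hx) (π.not_nested hy) h with h' | h'
  · have := π.chosen_iff_not hx hy h'
    tauto
  · have := π.chosen_iff_not hy hx h'
    tauto

/-- The closure only handles forcing by queried vertices. If `u` is unqueried, its neighbour `v` is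
queried because the cover meets the edge between them. -/
theorem forced_mem (hw : I.IsRealization w) {u v : Fin n} (h : I.Forces w u v) : v ∈ π.A := by
  by_cases hu : u ∈ π.A
  · exact π.closed_A u hu v h
  · by_contra hv
    have huD := fun h => hu (π.D_sub h)
    have hvD := fun h => hv (π.D_sub h)
    rcases π.chosen_or_chosen huD hvD (h.adj hw) with h' | h'
    · exact hu (π.cover_sub u huD h'.1.2)
    · exact hv (π.cover_sub v hvD h'.1.2)

theorem feasible (hw : I.IsRealization w) : I.Feasible w π.A := by
  rw [Input.feasible_iff hw]
  refine ⟨fun u v h => ?_, fun u v h => π.forced_mem hw h⟩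
  by_contra hno
  push Not at hno
  have huD := fun h => hno.1 (π.D_sub h)
  have hvD := fun h => hno.2 (π.D_sub h)
  rcases π.chosen_or_chosen huD hvD h with h' | h'
  · exact hno.1 (π.cover_sub u huD h'.1.2)
  · exact hno.2 (π.cover_sub v hvD h'.1.2)

/-- The partner of a chosen vertex: the left neighbour outside `D` in the components labelled from
the left, the right neighbour otherwise. -/
def Partner (c m : Fin n) : Prop :=
  m ∉ π.D ∧ ((π.g c = 1 ∧ I.LeftOf m c) ∨ (π.g c = 2 ∧ I.LeftOf c m))

theorem exists_partner {c : Fin n} (hc : π.Chosen c) : ∃ m, π.Partner c m := by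
  rcases hc.2 with h | h
  · have hg := π.g_spec c
    cases hl : π.left c with
    | none =>
      rw [hl] at hg
      -- A left end of a path has `g = par`, which is never `1`.
      rcases π.par_cases c with hp | hp <;> simp [hp] at hg <;> omega
    | some b =>
      obtain ⟨⟨_, hb, h'⟩, _⟩ := (π.left_spec c).2 b hl
      exact ⟨b, hb, Or.inl ⟨h, h'⟩⟩
  · have hh := π.h_spec c
    cases hl : π.right c with
    | none =>
      rw [hl] at hh
      simp at hh; omega
    | some b =>
      obtain ⟨⟨_, hb, h'⟩, _⟩ := (π.right_spec c).2 b hl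
      exact ⟨b, hb, Or.inr ⟨h.1, h'⟩⟩

theorem Partner.adj {π : Plan I w} {c m : Fin n} (h : π.Partner c m) : I.graph.Adj c m := by
  rcases h.2 with h' | h'
  · exact h'.2.adj.symm
  · exact h'.2.adj

theorem Partner.not_chosen {π : Plan I w} {c m : Fin n} (h : π.Partner c m) (hc : π.Chosen c) :
    ¬ π.Chosen m := by
  rcases π.chosen_or_chosen hc.1 h.1 h.adj with h' | h'
  · exact h'.2
  · exact absurd hc h'.2

/-- The type of labelling is constant along a path, so a vertex cannot be the left partner of one
vertex and the right partner of another; within one type, neighbours on a given side are unique. -/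
theorem Partner.injective {π : Plan I w} {c c' m : Fin n} (h : π.Partner c m)
    (h' : π.Partner c' m) (hc : π.Chosen c) (hc' : π.Chosen c') : c = c' := by
  have hcD := π.not_predicted hc.1
  have hcD' := π.not_predicted hc'.1
  have hm := π.not_predicted h.1
  rcases h.2 with ⟨g1, l1⟩ | ⟨g1, l1⟩ <;> rcases h'.2 with ⟨g2, l2⟩ | ⟨g2, l2⟩
  · exact Input.leftOf_right_unique hcD hcD' hm l1 l2
  · have e1 := π.g_right h.1 hc.1 l1
    have e2 := π.g_right hc'.1 h.1 l2
    rw [e2, g2] at e1; simp [flip] at e1; omega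
  · have e1 := π.g_right h.1 hc'.1 l2
    have e2 := π.g_right hc.1 h.1 l1
    rw [e2, g1] at e1; simp [flip] at e1; omega
  · exact Input.leftOf_left_unique hcD hcD' hm l1 l2

end Plan

/-! ### Query counts and prediction errors -/

namespace Plan

variable (π : Plan I w)

open Classical in
/-- The set of chosen vertices. -/
noncomputable def C : Finset (Fin n) := Finset.univ.filter π.Chosen

/-- The vertices that are queried only because their queried neighbours force it. -/
noncomputable def E : Finset (Fin n) := π.A \ (π.D ∪ π.C)

theorem mem_C {v : Fin n} : v ∈ π.C ↔ π.Chosen v := by simp [C]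

theorem mem_E {v : Fin n} : v ∈ π.E ↔ v ∈ π.A ∧ v ∉ π.D ∧ ¬ π.Chosen v := by
  simp [E, mem_C]

/-- Every vertex of `E` is forced by a chosen vertex. -/
theorem exists_forces_of_mem_E (hw : I.IsRealization w) {e : Fin n} (he : e ∈ π.E) :
    ∃ u, π.Chosen u ∧ I.Forces w u e := by
  rw [mem_E] at he
  obtain ⟨heA, heD, heC⟩ := he
  rcases π.mem_A e heA with h | h | ⟨u, hu⟩
  · exact absurd h heD
  · exact absurd ⟨heD, h⟩ heC
  · have huD : u ∉ π.D := fun h => heD (π.closed_D u h e hu)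
    rcases π.chosen_or_chosen huD heD (hu.adj hw) with h | h
    · exact ⟨u, h.1, hu⟩
    · exact absurd h.1 heC

theorem predicted_of_mem_D {v : Fin n} {O : Finset (Fin n)}
    (hO : ∀ u v, I.Forces w u v → v ∈ O) (hv : v ∈ π.D) (hvO : v ∉ O) : I.Predicted v := by
  rcases π.mem_D v hv with h | ⟨u, hu⟩
  · exact h
  · exact absurd (hO u v hu) hvO

/-- This replaces `D` by `O` in `|D| + |C| + |E|`. The term `|O \ D|` stays on the left as the
budget for `C`. -/
theorem card_A_add_le (O : Finset (Fin n)) :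
    π.A.card + (O \ π.D).card ≤ O.card + (π.D \ O).card + π.C.card + π.E.card := by
  have h1 : π.A.card ≤ π.D.card + π.C.card + π.E.card := by
    have : π.A ⊆ (π.D ∪ π.C) ∪ π.E := by
      intro v hv
      by_cases h : v ∈ π.D ∪ π.C
      · exact Finset.mem_union_left _ h
      · exact Finset.mem_union_right _ (Finset.mem_sdiff.mpr ⟨hv, h⟩)
    calc π.A.card ≤ _ := Finset.card_le_card this
      _ ≤ (π.D ∪ π.C).card + π.E.card := Finset.card_union_le _ _
      _ ≤ _ := by gcongr; exact Finset.card_union_le _ _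
  have h2 := Finset.card_inter_add_card_sdiff π.D O
  have h3 := Finset.card_inter_add_card_sdiff O π.D
  rw [Finset.inter_comm] at h3
  omega

/-- Each chosen vertex or its partner is in a given vertex cover `O`; the set `T` consists of chosen
vertices for which both are. -/
theorem card_C_add_le {O T : Finset (Fin n)}
    (hcov : ∀ u v, I.graph.Adj u v → u ∈ O ∨ v ∈ O)
    (hT : ∀ c ∈ T, π.Chosen c ∧ c ∈ O ∧ ∀ m, π.Partner c m → m ∈ O) :
    π.C.card + T.card ≤ (O \ π.D).card := by
  have hdisj : Disjoint (π.C \ O) T := by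
    rw [Finset.disjoint_left]
    intro c hc hcT
    exact (Finset.mem_sdiff.mp hc).2 (hT c hcT).2.1
  -- Partners embed both the chosen vertices outside `O` and those of `T` into the vertices of `O`
  -- that are neither chosen nor in `D`.
  have h1 : ((π.C \ O) ∪ T).card ≤ ((O \ π.D) \ π.C).card := by
    have hch : ∀ c ∈ (π.C \ O) ∪ T, π.Chosen c := by
      intro c hc
      rcases Finset.mem_union.mp hc with h | h
      · exact π.mem_C.mp (Finset.mem_sdiff.mp h).1
      · exact (hT c h).1
    refine Finset.card_le_card_of_forall_subsingleton π.Partner ?_ ?_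
    · intro c hc
      obtain ⟨m, hm⟩ := π.exists_partner (hch c hc)
      refine ⟨m, ?_, hm⟩
      have hmO : m ∈ O := by
        rcases Finset.mem_union.mp hc with h | h
        · exact (hcov c m hm.adj).resolve_left (Finset.mem_sdiff.mp h).2
        · exact (hT c h).2.2 m hm
      simp only [Finset.mem_sdiff, mem_C]
      exact ⟨⟨hmO, hm.1⟩, hm.not_chosen (hch c hc)⟩
    · rintro m - c ⟨hc, h⟩ c' ⟨hc', h'⟩
      exact h.injective h' (hch c hc) (hch c' hc')
  rw [Finset.card_union_of_disjoint hdisj] at h1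
  have h2 : (π.C ∩ O).card ≤ ((O \ π.D) ∩ π.C).card := by
    refine Finset.card_le_card fun c hc => ?_
    rw [Finset.mem_inter] at hc
    simp only [Finset.mem_inter, Finset.mem_sdiff]
    exact ⟨⟨hc.2, (π.mem_C.mp hc.1).1⟩, hc.1⟩
  have h3 := Finset.card_inter_add_card_sdiff π.C O
  have h4 := Finset.card_inter_add_card_sdiff (O \ π.D) π.C
  omega

theorem card_A_le {O : Finset (Fin n)} (hcov : ∀ u v, I.graph.Adj u v → u ∈ O ∨ v ∈ O) :
    π.A.card ≤ O.card + (π.D \ O).card + π.E.card := by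
  have h1 := π.card_A_add_le O
  have h2 := π.card_C_add_le (T := ∅) hcov (by simp)
  simp at h2
  omega

theorem card_le_errMandatory (hw : I.IsRealization w) {O : Finset (Fin n)}
    (hO : I.Feasible w O) : π.A.card ≤ O.card + I.errMandatory w := by
  classical
  rw [Input.feasible_iff hw] at hO
  have h1 := π.card_A_le hO.1
  have hdisj : Disjoint (π.D \ O) π.E := by
    rw [Finset.disjoint_left]
    intro v hv hv'
    exact (π.mem_E.mp hv').2.1 (Finset.mem_sdiff.mp hv).1
  have h2 : ((π.D \ O) ∪ π.E).card ≤ I.errMandatory w := by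
    unfold Input.errMandatory
    rw [← Set.ncard_coe_finset]
    refine Set.ncard_le_ncard ?_ (Set.toFinite _)
    intro v hv
    rw [Set.mem_symmDiff, Input.mem_mandatory_iff hw,
      Input.mem_mandatory_iff I.isRealization_pred]
    rcases Finset.mem_union.mp (Finset.mem_coe.mp hv) with h | h
    · rw [Finset.mem_sdiff] at h
      exact Or.inl ⟨π.predicted_of_mem_D hO.2 h.1 h.2, fun ⟨u, hu⟩ => h.2 (hO.2 u v hu)⟩
    · obtain ⟨u, _, hu⟩ := π.exists_forces_of_mem_E hw h
      exact Or.inr ⟨⟨u, hu⟩, π.not_predicted (π.mem_E.mp h).2.1⟩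
  rw [Finset.card_union_of_disjoint hdisj] at h2
  omega

/-- If the predicted weight of a chosen vertex `c` wrongly claims that `v` is mandatory, and the
precise weight of `c` forces a neighbour of `c`, then also the partner of `c` is in every cover
that avoids `v`. -/
theorem partner_mem (hw : I.IsRealization w) {O : Finset (Fin n)}
    (hcov : ∀ u v, I.graph.Adj u v → u ∈ O ∨ v ∈ O)
    (hforce : ∀ u v, I.Forces w u v → v ∈ O) {c e v m : Fin n} (hc : π.Chosen c)
    (heD : e ∉ π.D) (he : I.Forces w c e) (hv : I.Forces I.pred c v) (hvO : v ∉ O)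
    (hm : π.Partner c m) : m ∈ O := by
  by_cases hme : m = e
  · exact hme ▸ hforce c e he
  have hcP := π.not_predicted hc.1
  have hcN := π.not_nested hc.1
  have hnv : ¬ (I.lower v < w c ∧ w c < I.upper v) := fun h => hvO (hforce c v ⟨hv.1, h⟩)
  have hne : ¬ (I.lower e < I.pred c ∧ I.pred c < I.upper e) := fun h =>
    π.not_predicted heD ⟨c, he.1, h⟩
  have hvc : ¬ (I.lower c ≤ I.lower v ∧ I.upper v ≤ I.upper c) := fun h =>
    hcN ⟨v, hv.1.symm, h⟩
  have hpc := I.pred_mem c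
  have hwc := hw c
  -- It suffices that `v` and `m` are adjacent, as `O` avoids `v`. Since `m ≠ e`, these are the two
  -- neighbours of `c` on opposite sides.
  have hadj : I.graph.Adj v m := by
    have hvm : v ≠ m := by
      rintro rfl
      exact π.not_predicted hm.1 ⟨c, hv⟩
    rw [Input.adj_iff]
    refine ⟨hvm, ?_⟩
    have hv1 := hv.2.1
    have hv2 := hv.2.2
    rcases Input.leftOf_or_leftOf hcN (π.not_nested heD) (he.adj hw) with h | h <;>
      rcases Input.leftOf_or_leftOf hcN (π.not_nested hm.1) hm.adj with h' | h'
    · exact absurd (Input.leftOf_right_unique (π.not_predicted hm.1) (π.not_predicted heD) hcP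
        h' h) hme
    -- Here `e` is on the right and `m` on the left. The weight of `c` moves right into `I_e` and
    -- passes the right end of `I_v`; as `I_c` does not contain `I_v`, the latter sticks out of
    -- `I_c` on the left and meets `I_m`. The next case is the mirror image.
    · have hu := Input.upper_lt_of_lower_lt hcN h.1
      have h1 : I.pred c ≤ I.lower e := by
        by_contra h2
        exact hne ⟨not_le.mp h2, hpc.2.trans hu⟩
      have h3 : I.pred c < w c := h1.trans_lt he.2.1
      have h4 : I.upper v ≤ w c := by
        by_contra h2
        exact hnv ⟨hv1.trans h3, not_le.mp h2⟩
      have h5 : I.lower v < I.lower c := by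
        by_contra h2
        exact hvc ⟨not_lt.mp h2, h4.trans hwc.2.le⟩
      exact ⟨h5.trans h'.2, h'.1.trans (hpc.1.trans hv2)⟩
    · have hu := Input.upper_lt_of_lower_lt (π.not_nested heD) h.1
      have h1 : I.upper e ≤ I.pred c := by
        by_contra h2
        exact hne ⟨h.1.trans hpc.1, not_le.mp h2⟩
      have h3 : w c < I.pred c := he.2.2.trans_le h1
      have h4 : w c ≤ I.lower v := by
        by_contra h2
        exact hnv ⟨not_le.mp h2, h3.trans hv2⟩
      have h5 : I.upper c < I.upper v := by
        by_contra h2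
        exact hvc ⟨hwc.1.le.trans h4, not_lt.mp h2⟩
      have h6 := Input.upper_lt_of_lower_lt hcN h'.1
      exact ⟨hv1.trans (hpc.2.trans h6), h'.2.trans h5⟩
    · exact absurd (Input.leftOf_left_unique (π.not_predicted hm.1) (π.not_predicted heD) hcP
        h' h) hme
  exact (hcov v m hadj).resolve_left hvO

/-- `D \ O` is injected into `W₁` and `E` into `W₂`, both sets of wrongly predicted vertices. Their
overlap would be counted twice, but it serves as the set `T` in `card_C_add_le`. -/
theorem card_le_errCount (hw : I.IsRealization w) {O : Finset (Fin n)}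
    (hO : I.Feasible w O) : π.A.card ≤ O.card + I.errCount w := by
  classical
  rw [Input.feasible_iff hw] at hO
  obtain ⟨hcov, hforce⟩ := hO
  set W : Finset (Fin n) := Finset.univ.filter fun v => w v ≠ I.pred v with hW
  have hWc : I.errCount w = W.card := by
    unfold Input.errCount
    rw [← Set.ncard_coe_finset]
    simp [hW]
  set W₁ := W.filter fun u => ∃ v ∈ π.D \ O, I.Forces I.pred u v with hW₁
  set W₂ := W.filter fun u => π.Chosen u ∧ ∃ e ∈ π.E, I.Forces w u e with hW₂
  have h1 : (π.D \ O).card ≤ W₁.card := by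
    refine Finset.card_le_card_of_forall_subsingleton (fun v u => I.Forces I.pred u v) ?_ ?_
    · intro v hv
      have hv' := Finset.mem_sdiff.mp hv
      obtain ⟨u, hu⟩ := π.predicted_of_mem_D hforce hv'.1 hv'.2
      refine ⟨u, ?_, hu⟩
      simp only [hW₁, hW, Finset.mem_filter, Finset.mem_univ, true_and]
      refine ⟨fun h => hv'.2 (hforce u v ⟨hu.1, by rw [h]; exact hu.2⟩), v, hv, hu⟩
    -- Two vertices forced by `u` are adjacent, and `O` cannot miss both.
    · rintro u - a ⟨ha, hua⟩ b ⟨hb, hub⟩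
      exact Input.eq_of_forces hcov hua hub (Finset.mem_sdiff.mp ha).2 (Finset.mem_sdiff.mp hb).2
  have h2 : π.E.card ≤ W₂.card := by
    refine Finset.card_le_card_of_forall_subsingleton (fun e u => I.Forces w u e) ?_ ?_
    · intro e he
      obtain ⟨u, huC, hu⟩ := π.exists_forces_of_mem_E hw he
      refine ⟨u, ?_, hu⟩
      simp only [hW₂, hW, Finset.mem_filter, Finset.mem_univ, true_and]
      refine ⟨fun h => π.not_predicted (π.mem_E.mp he).2.1 ⟨u, hu.1, ?_⟩, huC, e, he, hu⟩
      rw [← h]; exact hu.2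
    · rintro u - a ⟨ha, hua⟩ b ⟨hb, hub⟩
      -- Two such vertices would be adjacent and both unchosen.
      rw [π.mem_E] at ha hb
      by_contra hne
      rcases π.chosen_or_chosen ha.2.1 hb.2.1 ⟨hne, w u, hua.2, hub.2⟩ with h | h
      · exact ha.2.2 h.1
      · exact hb.2.2 h.1
  have h3 : (W₁ ∪ W₂).card ≤ W.card :=
    Finset.card_le_card (Finset.union_subset (Finset.filter_subset _ _) (Finset.filter_subset _ _))
  have h4 : π.C.card + (W₁ ∩ W₂).card ≤ (O \ π.D).card := by
    refine π.card_C_add_le hcov fun c hc => ?_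
    simp only [hW₁, hW₂, Finset.mem_inter, Finset.mem_filter] at hc
    obtain ⟨⟨_, v, hv, hcv⟩, _, hcC, e, he, hce⟩ := hc
    rw [Finset.mem_sdiff] at hv
    refine ⟨hcC, (hcov c v (hcv.adj I.isRealization_pred)).resolve_right hv.2, fun m hm => ?_⟩
    exact π.partner_mem hw hcov hforce hcC (π.mem_E.mp he).2.1 hce hcv hv.2 hm
  have h5 := Finset.card_union_add_card_inter W₁ W₂
  have h6 := π.card_A_add_le O
  omega

end Plan

-- A vertex `v` with wrong status has a witness `u` whose weight is in `I_v` for exactly one of the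
-- two weight vectors, so `u` hops over an endpoint of `I_v`. The pairs `(u, v)` are distinct for
-- distinct `v`.
open Classical in
theorem Input.errMandatory_le_errHop {I : Input n} {w : Fin n → ℝ} (hw : I.IsRealization w) :
    I.errMandatory w ≤ I.errHop w := by
  set S : Finset (Fin n) := Finset.univ.filter fun v =>
    v ∈ symmDiff (I.mandatory I.pred) (I.mandatory w) with hS
  have h1 : I.errMandatory w = S.card := by
    unfold Input.errMandatory
    rw [← Set.ncard_coe_finset]
    simp [hS]
  set T : Finset (Fin n × Fin n) := Finset.univ.filter fun p =>
    p.2 ≠ p.1 ∧ I.Hops w p.2 p.1 with hT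
  have h2 : I.errHop w = T.card := by
    unfold Input.errHop
    rw [Finset.card_filter, Fintype.sum_prod_type]
    refine Finset.sum_congr rfl fun v _ => ?_
    rw [← Finset.sum_subset (Finset.erase_subset v Finset.univ)]
    · refine Finset.sum_congr rfl fun u hu => ?_
      simp [(Finset.mem_erase.mp hu).1]
    · intro u _ hu
      have : u = v := by simpa using hu
      simp [this]
  rw [h1, h2]
  refine Finset.card_le_card_of_forall_subsingleton (fun v p => p.2 = v) ?_ ?_
  · intro v hv
    simp only [hS, Finset.mem_filter, Finset.mem_univ, true_and, Set.mem_symmDiff,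
      mem_mandatory_iff hw, mem_mandatory_iff I.isRealization_pred, not_exists] at hv
    rcases hv with ⟨⟨u, hne, hu⟩, hno⟩ | ⟨⟨u, hne, hu⟩, hno⟩
    · refine ⟨(u, v), ?_, rfl⟩
      simp only [hT, Finset.mem_filter, Finset.mem_univ, true_and]
      refine ⟨hne.symm, ?_⟩
      have := hno u
      simp only [Forces, not_and, not_lt] at this
      have := this hne
      unfold Hops
      rcases le_or_gt (w u) (I.lower v) with h | h
      · exact Or.inr (Or.inl ⟨h, hu.1⟩)
      · exact Or.inr (Or.inr (Or.inr ⟨hu.2, this h⟩))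
    · refine ⟨(u, v), ?_, rfl⟩
      simp only [hT, Finset.mem_filter, Finset.mem_univ, true_and]
      refine ⟨hne.symm, ?_⟩
      have := hno u
      simp only [Forces, not_and, not_lt] at this
      have := this hne
      unfold Hops
      rcases le_or_gt (I.pred u) (I.lower v) with h | h
      · exact Or.inl ⟨h, hu.1⟩
      · exact Or.inr (Or.inr (Or.inl ⟨hu.2, this h⟩))
  · rintro p - a ⟨_, ha⟩ b ⟨_, hb⟩
    exact ha.symm.trans hb

/-! ### Robustness: chains of non-nested vertices -/

namespace Plan

variable (π : Plan I w)

/-- `y` precedes `h` (or is equal to it) in its component of the graph on the non-nested vertices. -/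
def Reach (y h : Fin n) : Prop := Relation.ReflTransGen (fun a b => π.prev b = some a) y h

theorem prev_prop {a b : Fin n} (h : π.prev a = some b) :
    ¬ I.Nested a ∧ ¬ I.Nested b ∧ I.LeftOf b a := ((π.prev_spec a).2 b h).1

theorem prev_max {a b c : Fin n} (h : π.prev a = some b) (hc : ¬ I.Nested c)
    (hca : I.LeftOf c a) : I.lower c ≤ I.lower b :=
  ((π.prev_spec a).2 b h).2 c ⟨(π.prev_prop h).1, hc, hca⟩

/-- If `a` and `a'` both pointed to `b`, with `a` further left, then `I_a` would reach beyond `I_b`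
and contain `lower a'`, so `a` would be a better pointer for `a'`. Hence the pointers form chains
without branching. -/
theorem prev_injective {a a' b : Fin n} (h : π.prev a = some b) (h' : π.prev a' = some b) :
    a = a' := by
  have key : ∀ a a', π.prev a = some b → π.prev a' = some b → ¬ I.lower a < I.lower a' := by
    intro a a' h h' hlt
    obtain ⟨ha, hb, hba⟩ := π.prev_prop h
    obtain ⟨ha', _, hba'⟩ := π.prev_prop h'
    have h1 := Input.upper_lt_of_lower_lt hb hba.1
    exact ((π.prev_max h' ha ⟨hlt, hba'.2.trans h1⟩).trans_lt hba.1).false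
  by_contra hne
  rcases Input.lower_upper_lt (π.prev_prop h).1 (π.prev_prop h').1 hne with h1 | h1
  · exact key a a' h h' h1.1
  · exact key a' a h' h h1.1

/-- A left neighbour `u` of `v` other than `prev v` starts before `prev v` and extends beyond `lower
v`, so it is also a left neighbour of `prev v`. -/
theorem reach_of_leftOf {u v : Fin n} (hu : ¬ I.Nested u) (hv : ¬ I.Nested v)
    (huv : I.LeftOf u v) : π.Reach u v := by
  induction v using I.lower_induction with
  | h v ih =>
    cases hp : π.prev v with
    | none => exact absurd ⟨hv, hu, huv⟩ ((π.prev_spec v).1 hp u)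
    | some p =>
      obtain ⟨_, hpN, hpv⟩ := π.prev_prop hp
      by_cases hup : u = p
      · exact Relation.ReflTransGen.single (by rw [hup]; exact hp)
      · have h1 := π.prev_max hp hu huv
        have h2 : I.lower u < I.lower p := by
          rcases Input.lower_upper_lt hu hpN hup with h | h
          · exact h.1
          · exact absurd h.1 h1.not_gt
        exact (ih p hpv.1 hpN ⟨h2, hpv.1.trans huv.2⟩).tail hp

theorem reach_total {y a b : Fin n} (ha : π.Reach y a) (hb : π.Reach y b) :
    π.Reach a b ∨ π.Reach b a :=
  Relation.ReflTransGen.total_of_right_unique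
    (fun _ _ _ h1 h2 => π.prev_injective h1 h2) ha hb

theorem eq_of_reach_of_last {b z : Fin n} (hlast : ∀ h, π.prev h ≠ some b) (h : π.Reach b z) :
    z = b := by
  rcases Relation.ReflTransGen.cases_head h with h' | ⟨c, hc, _⟩
  · exact h'.symm
  · exact absurd hc (hlast c)

/-- Chains are closed under adjacency among non-nested vertices, so they are the components of that
graph. -/
theorem reach_last_of_adj {b y z : Fin n} (hlast : ∀ h, π.prev h ≠ some b) (hy : ¬ I.Nested y)
    (hz : ¬ I.Nested z) (hyz : I.graph.Adj y z) (h : π.Reach y b) : π.Reach z b := by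
  rcases Input.leftOf_or_leftOf hy hz hyz with h' | h'
  · rcases π.reach_total h (π.reach_of_leftOf hy hz h') with h1 | h1
    · rw [π.eq_of_reach_of_last hlast h1]; exact Relation.ReflTransGen.refl
    · exact h1
  · exact (π.reach_of_leftOf hz hy h').trans h

theorem not_nested_of_reach {y b : Fin n} (h : π.Reach y b) (hb : ¬ I.Nested b) :
    ¬ I.Nested y := by
  rcases Relation.ReflTransGen.cases_head h with h' | ⟨c, hc, _⟩
  · exact h' ▸ hb
  · exact (π.prev_prop hc).2.1

theorem par_prev {a b : Fin n} (h : π.prev a = some b) : π.par a = 2 - π.par b := by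
  rw [π.par_spec a, h]; rfl

/-- Up to `h`, the component of `h` alternates between vertices outside `O` and in `O`. -/
def Alternating (O : Finset (Fin n)) (h : Fin n) : Prop :=
  ∀ y, π.Reach y h → (y ∈ O ↔ π.par y = 2)

theorem Alternating.step {π : Plan I w} {O : Finset (Fin n)} {a b : Fin n}
    (h : π.prev a = some b) (hb : π.Alternating O b) (ha : a ∈ O ↔ π.par a = 2) :
    π.Alternating O a := by
  intro y hy
  rcases Relation.ReflTransGen.cases_tail hy with h' | ⟨c, hc, hca⟩
  · exact h' ▸ ha
  · have : c = b := by rw [h] at hca; exact (Option.some.inj hca).symm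
    exact hb y (this ▸ hc)

/-- The excess of an initial part of a component: twice the number of vertices in `O` minus the
number of all vertices. -/
theorem excess_bounds {O : Finset (Fin n)} (hcov : ∀ u v, I.graph.Adj u v → u ∈ O ∨ v ∈ O)
    {S : Fin n → ℤ}
    (hS : ∀ a, S a = (if a ∈ O then 1 else -1) + ((π.prev a).map S).elim 0 id) (h : Fin n) :
    (π.par h = 0 → -1 ≤ S h ∧ S h % 2 = 1 ∧ (S h = -1 → π.Alternating O h)) ∧
      (π.par h = 2 → 0 ≤ S h ∧ S h % 2 = 0 ∧ (S h = 0 → h ∈ O → π.Alternating O h)) := by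
  induction h using I.lower_induction with
  | h a ih =>
    have hSa := hS a
    cases hp : π.prev a with
    | none =>
      have hpar : π.par a = 0 := by rw [π.par_spec a, hp]; rfl
      rw [hp] at hSa
      simp only [Option.map_none, Option.elim_none, add_zero] at hSa
      refine ⟨fun _ => ?_, fun h => by omega⟩
      split_ifs at hSa with haO
      · exact ⟨by omega, by omega, fun h => by omega⟩
      · refine ⟨by omega, by omega, fun _ y hy => ?_⟩
        rcases Relation.ReflTransGen.cases_tail hy with h' | ⟨c, _, hca⟩
        · subst h'; simp [haO, hpar]
        · rw [hp] at hca; cases hca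
    | some b =>
      obtain ⟨_, _, hba⟩ := π.prev_prop hp
      obtain ⟨ih0, ih2⟩ := ih b hba.1
      have hpar := π.par_prev hp
      have hor := hcov b a hba.adj
      rw [hp] at hSa
      simp only [Option.map_some, Option.elim_some, id_eq] at hSa
      have hSb := hS b
      constructor
      · intro ha0
        have hb2 : π.par b = 2 := by rcases π.par_cases b with h | h <;> omega
        obtain ⟨i1, i2, i3⟩ := ih2 hb2
        split_ifs at hSa with haO
        · exact ⟨by omega, by omega, fun h => by omega⟩
        · have hbO := hor.resolve_right haO
          refine ⟨by omega, by omega, fun h => ?_⟩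
          exact (i3 (by omega) hbO).step hp (by simp [haO, ha0])
      · intro ha2
        have hb0 : π.par b = 0 := by rcases π.par_cases b with h | h <;> omega
        obtain ⟨i1, i2, i3⟩ := ih0 hb0
        split_ifs at hSa with haO
        · refine ⟨by omega, by omega, fun h _ => ?_⟩
          exact (i3 (by omega)).step hp (by simp [haO, ha2])
        · have hbO := hor.resolve_right haO
          -- Value `-1` would put `b` outside `O`, but `b` must cover the edge to `a`.
          have hne : S b ≠ -1 := fun h => by
            have := (i3 h b Relation.ReflTransGen.refl).mp hbO
            omega
          exact ⟨by omega, by omega, fun _ h => absurd h haO⟩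

/-- A component that alternates and is queried completely contains no vertex outside `D`. -/
theorem mem_D_of_alternating (hw : I.IsRealization w) {O : Finset (Fin n)}
    (hforce : ∀ u v, I.Forces w u v → v ∈ O) {b : Fin n} (hlast : ∀ h, π.prev h ≠ some b)
    (halt : π.Alternating O b) (hA : ∀ y, π.Reach y b → y ∈ π.A)
    {y : Fin n} (hy : π.Reach y b) : y ∈ π.D := by
  classical
  have hadj : ∀ {x z}, x ∉ π.D → z ∉ π.D → I.graph.Adj x z → π.Reach x b → π.Reach z b :=
    fun hx hz h => π.reach_last_of_adj hlast (π.not_nested hx) (π.not_nested hz) h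
  -- An unchosen queried vertex outside `D` is forced, hence in `O`, hence at an even position.
  have hE : ∀ {x}, x ∉ π.D → ¬ π.Chosen x → π.Reach x b →
      (∃ u, π.Chosen u ∧ I.Forces w u x) ∧ π.par x = 2 := by
    intro x hx hxC hxb
    obtain ⟨u, hu⟩ := π.exists_forces_of_mem_E hw (π.mem_E.mpr ⟨hA x hxb, hx, hxC⟩)
    exact ⟨⟨u, hu⟩, (halt x hxb).mp (hforce u x hu.2)⟩
  -- A left end at an odd position would be left unchosen and thus contradict `hE`. So every path
  -- here starts at an even position and omits its right end.
  have hg : ∀ x, x ∉ π.D → π.Reach x b → π.g x = 2 := by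
    intro x
    induction x using I.lower_induction with
    | h x ih =>
      intro hx hxb
      cases hl : π.left x with
      | some z =>
        obtain ⟨⟨_, hz, hzx⟩, _⟩ := (π.left_spec x).2 z hl
        have := ih z hzx.1 hz (hadj hx hz hzx.adj.symm hxb)
        rw [π.g_right hz hx hzx, this]; rfl
      | none =>
        have hgx : π.g x = π.par x := by rw [π.g_spec x, hl]; rfl
        by_cases hxC : π.Chosen x
        · rcases π.par_cases x with h | h
          · rcases hxC.2 with h' | h' <;> omega
          · omega
        · rw [hgx]; exact (hE hx hxC hxb).2
  -- Forcing must come from the right, by induction along the path. At the right end this is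
  -- impossible, which gives the final contradiction.
  have hright : ∀ x, x ∉ π.D → π.Reach x b → ¬ π.Chosen x →
      ∃ u, u ∉ π.D ∧ I.LeftOf x u ∧ I.Forces w u x := by
    intro x
    induction x using I.lower_induction with
    | h x ih =>
      intro hx hxb hxC
      obtain ⟨⟨u, huC, hu⟩, hxpar⟩ := hE hx hxC hxb
      rcases Input.leftOf_or_leftOf (π.not_nested hx) (π.not_nested huC.1) (hu.adj hw).symm
        with h | hux
      · exact ⟨u, huC.1, h, hu⟩
      exfalso
      have hub := hadj hx huC.1 hux.adj.symm hxb
      cases hl : π.left u with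
      | some z =>
        obtain ⟨⟨_, hz, hzu⟩, _⟩ := (π.left_spec u).2 z hl
        -- By induction `u` also forces its left neighbour `z`, so the weight of `u` is common to
        -- the intervals of `z` and `x`: a triangle.
        have hzC : ¬ π.Chosen z := fun h => (π.chosen_iff_not hz huC.1 hzu).mp h huC
        obtain ⟨u', hu', hzu', hf⟩ :=
          ih z (hzu.1.trans hux.1) hz (hadj huC.1 hz hzu.adj.symm hub) hzC
        have : u' = u := Input.leftOf_right_unique (π.not_predicted hu')
          (π.not_predicted huC.1) (π.not_predicted hz) hzu' hzu
        subst this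
        exact Input.no_triangle (π.not_predicted hz) (π.not_predicted huC.1)
          (π.not_predicted hx) hzu.1 hux.1 (hu.2.1.trans hf.2.2)
      | none =>
        have hupar : π.par u = 2 := by
          rw [← hg u huC.1 hub, π.g_spec u, hl]; rfl
        cases hp : π.prev x with
        | none =>
          have : π.par x = 0 := by rw [π.par_spec x, hp]; rfl
          omega
        | some p =>
          obtain ⟨hxN, hpN, hpx⟩ := π.prev_prop hp
          have hppar : π.par p = 0 := by
            have := π.par_prev hp
            rcases π.par_cases p with h | h <;> omega
          have hpb : π.Reach p b := Relation.ReflTransGen.head hp hxb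
          -- `u` and `x` both have even positions, so another vertex `p = prev x` at an odd position
          -- lies between them. The weight of `u` then lies in `I_p` too, which puts `p` into `O`
          -- against alternation.
          have hup : u ≠ p := fun h => by rw [h] at hupar; omega
          have h1 := π.prev_max hp (π.not_nested huC.1) hux
          have h2 : I.upper u < I.upper p := by
            rcases Input.lower_upper_lt (π.not_nested huC.1) hpN hup with h | h
            · exact h.2
            · exact absurd h.1 h1.not_gt
          have := (halt p hpb).mp (hforce u p ⟨hup, hpx.1.trans hu.2.1, (hw u).2.trans h2⟩)
          omega
  by_contra hyD
  obtain ⟨x, hx, hmax⟩ := Finset.exists_max_image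
    (Finset.univ.filter fun x => x ∉ π.D ∧ π.Reach x b) I.lower ⟨y, by simp [hyD, hy]⟩
  simp only [Finset.mem_filter, Finset.mem_univ, true_and] at hx hmax
  have hno : ∀ u, u ∉ π.D → ¬ I.LeftOf x u := fun u hu h =>
    (hmax u ⟨hu, hadj hx.1 hu h.adj hx.2⟩).not_gt h.1
  by_cases hxC : π.Chosen x
  · have hgx := hg x hx.1 hx.2
    have hhx : π.h x = 1 := by rcases hxC.2 with h | h <;> omega
    have hh := π.h_spec x
    cases hr : π.right x with
    | none => rw [hr] at hh; simp at hh; omega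
    | some u =>
      obtain ⟨⟨_, hu, h⟩, _⟩ := (π.right_spec x).2 u hr
      exact hno u hu h
  · obtain ⟨u, hu, h, _⟩ := hright x hx.1 hx.2 hxC
    exact hno u hu h

/-- A component that alternates, ends outside `O` and is queried completely contains a vertex outside
`O` that is predicted to be mandatory because of a vertex whose interval is nested. -/
theorem exists_nested_of_alternating (hw : I.IsRealization w) {O : Finset (Fin n)}
    (hcov : ∀ u v, I.graph.Adj u v → u ∈ O ∨ v ∈ O)
    (hforce : ∀ u v, I.Forces w u v → v ∈ O) {b : Fin n} (hlast : ∀ h, π.prev h ≠ some b)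
    (hbN : ¬ I.Nested b) (hbpar : π.par b = 0) (halt : π.Alternating O b)
    (hA : ∀ y, π.Reach y b → y ∈ π.A) :
    ∃ z v, I.Nested z ∧ π.Reach v b ∧ v ∉ O ∧ I.Forces I.pred z v := by
  classical
  by_contra hno
  push Not at hno
  set odd := Finset.univ.filter fun y => π.Reach y b ∧ π.par y = 0 with hodd
  set even := Finset.univ.filter fun y => π.Reach y b ∧ π.par y = 2 with heven
  -- Without nested causes, each odd vertex is predicted mandatory because of an even vertex of the
  -- chain, and distinct odd vertices have distinct causes. But a chain that ends at the odd vertex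
  -- `b` has one more odd vertex than even ones.
  have h1 : odd.card ≤ even.card := by
    refine Finset.card_le_card_of_forall_subsingleton (fun v u => I.Forces I.pred u v) ?_ ?_
    · intro v hv
      simp only [hodd, Finset.mem_filter, Finset.mem_univ, true_and] at hv
      have hvO : v ∉ O := fun h => by have := (halt v hv.1).mp h; omega
      obtain ⟨u, hu⟩ := π.predicted_of_mem_D hforce
        (π.mem_D_of_alternating hw hforce hlast halt hA hv.1) hvO
      have huN : ¬ I.Nested u := fun h => hno u v h hv.1 hvO hu
      have huv := hu.adj I.isRealization_pred
      have hub := π.reach_last_of_adj hlast (π.not_nested_of_reach hv.1 hbN) huN huv.symm hv.1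
      refine ⟨u, ?_, hu⟩
      simp only [heven, Finset.mem_filter, Finset.mem_univ, true_and]
      exact ⟨hub, (halt u hub).mp ((hcov u v huv).resolve_right hvO)⟩
    · rintro u - x ⟨hx, hux⟩ y ⟨hy, huy⟩
      replace hx := (Finset.mem_filter.mp (Finset.mem_coe.mp hx)).2
      replace hy := (Finset.mem_filter.mp (Finset.mem_coe.mp hy)).2
      refine Input.eq_of_forces hcov hux huy (fun h => ?_) (fun h => ?_)
      · have := (halt x hx.1).mp h; omega
      · have := (halt y hy.1).mp h; omega
  have h2 : even.card ≤ (odd.erase b).card := by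
    refine Finset.card_le_card_of_forall_subsingleton (fun y p => π.prev y = some p) ?_ ?_
    · intro y hy
      simp only [heven, Finset.mem_filter, Finset.mem_univ, true_and] at hy
      cases hp : π.prev y with
      | none =>
        have : π.par y = 0 := by rw [π.par_spec y, hp]; rfl
        omega
      | some p =>
        refine ⟨p, ?_, rfl⟩
        simp only [hodd, Finset.mem_erase, Finset.mem_filter, Finset.mem_univ, true_and]
        refine ⟨fun h => hlast y (h ▸ hp), Relation.ReflTransGen.head hp hy.1, ?_⟩
        have := π.par_prev hp
        rcases π.par_cases p with h | h <;> omega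
    · rintro p - x ⟨_, hx⟩ y ⟨_, hy⟩
      exact π.prev_injective hx hy
  have h3 : b ∈ odd := by
    simp only [hodd, Finset.mem_filter, Finset.mem_univ, true_and]
    exact ⟨Relation.ReflTransGen.refl, hbpar⟩
  have h4 := Finset.card_erase_lt_of_mem h3
  omega

/-- The sum telescopes: since `prev` is injective, the partial sum at each vertex is passed on
exactly once, except at the last vertex of a chain. -/
theorem sum_excess {S : Fin n → ℤ} {val : Fin n → ℤ}
    (hS : ∀ a, S a = val a + ((π.prev a).map S).elim 0 id) (H : Finset (Fin n))
    (hH : ∀ a b, π.prev a = some b → a ∈ H ∧ b ∈ H) (L : Finset (Fin n))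
    (hL : ∀ b, b ∈ L ↔ b ∈ H ∧ ∀ a, π.prev a ≠ some b) :
    ∑ a ∈ H, val a = ∑ b ∈ L, S b := by
  classical
  have h1 : ∀ a ∈ H, ((π.prev a).map S).elim 0 id = ∑ b ∈ H, if π.prev a = some b then S b else 0 := by
    intro a _
    cases hp : π.prev a with
    | none => simp
    | some c => simp [(hH a c hp).2]
  have h2 : ∀ b ∈ H, (∑ a ∈ H, if π.prev a = some b then S b else 0) = if b ∈ L then 0 else S b := by
    intro b hb
    by_cases hbL : b ∈ L
    · rw [if_pos hbL]
      refine Finset.sum_eq_zero fun a _ => if_neg (((hL b).mp hbL).2 a)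
    · rw [if_neg hbL]
      have : ∃ a, π.prev a = some b := by
        by_contra hno
        push Not at hno
        exact hbL ((hL b).mpr ⟨hb, hno⟩)
      obtain ⟨a, ha⟩ := this
      rw [Finset.sum_eq_single_of_mem a (hH a b ha).1]
      · rw [if_pos ha]
      · intro a' _ hne
        exact if_neg fun h => hne (π.prev_injective h ha)
  have h3 : ∑ a ∈ H, S a = ∑ a ∈ H, val a + ∑ b ∈ H, if b ∈ L then 0 else S b := by
    rw [← Finset.sum_congr rfl h2, Finset.sum_comm, ← Finset.sum_add_distrib]
    refine Finset.sum_congr rfl fun a ha => ?_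
    rw [hS a, h1 a ha]
  have h4 : ∑ a ∈ H, S a = ∑ b ∈ L, S b + ∑ b ∈ H, if b ∈ L then 0 else S b := by
    have hLH : L ⊆ H := fun b hb => ((hL b).mp hb).1
    have h5 : ∑ b ∈ L, S b = ∑ b ∈ H, if b ∈ L then S b else 0 := by
      rw [← Finset.sum_filter, Finset.filter_mem_eq_inter, Finset.inter_eq_right.mpr hLH]
    rw [h5, ← Finset.sum_add_distrib]
    refine Finset.sum_congr rfl fun b _ => ?_
    split_ifs <;> simp
  linarith

theorem card_le_two_mul (hw : I.IsRealization w) {O : Finset (Fin n)} (hO : I.Feasible w O) :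
    π.A.card ≤ 2 * O.card := by
  classical
  rw [Input.feasible_iff hw] at hO
  obtain ⟨hcov, hforce⟩ := hO
  obtain ⟨S, hS⟩ := exists_recursive π.prev I.rank
    (fun a b h => Input.rank_lt_rank (π.prev_prop h).2.2.1)
    (fun a o => (if a ∈ O then (1 : ℤ) else -1) + o.elim 0 id)
  set N := Finset.univ.filter fun v => I.Nested v with hN
  set H := Finset.univ.filter fun v => ¬ I.Nested v with hH
  set L := H.filter fun b => ∀ a, π.prev a ≠ some b with hL
  -- The last vertices of the chains with deficit one.
  set B := L.filter fun b => S b = -1 with hB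
  have hsum := π.sum_excess hS H
    (fun a b h => by
      have := π.prev_prop h
      simp [hH, this.1, this.2.1]) L (fun b => by simp [hL])
  have hval : ∑ a ∈ H, (if a ∈ O then (1 : ℤ) else -1) = 2 * (H ∩ O).card - H.card := by
    rw [Finset.sum_ite, Finset.sum_const, Finset.sum_const, Finset.filter_mem_eq_inter,
      Finset.filter_notMem_eq_sdiff]
    have := Finset.card_inter_add_card_sdiff H O
    simp
    omega
  have hbound := fun h => π.excess_bounds hcov hS h
  have hSB : -(B.card : ℤ) ≤ ∑ b ∈ L, S b := by
    have : -(B.card : ℤ) = ∑ b ∈ L, if S b = -1 then (-1 : ℤ) else 0 := by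
      rw [Finset.sum_ite, Finset.sum_const, Finset.sum_const_zero]
      simp [hB]
    rw [this]
    refine Finset.sum_le_sum fun b _ => ?_
    split_ifs with h
    · omega
    · rcases π.par_cases b with hp | hp
      · have := (hbound b).1 hp; omega
      · have := (hbound b).2 hp; omega
  -- Each deficient chain is charged to an unqueried vertex of its own or to a nested vertex. A
  -- nested vertex is charged at most once, since it falsely predicts at most one vertex outside the
  -- cover `O`.
  have hBc : B.card ≤ ((H \ π.A) ∪ N).card := by
    have hBp : ∀ b ∈ B, ¬ I.Nested b ∧ (∀ a, π.prev a ≠ some b) ∧ π.par b = 0 ∧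
        π.Alternating O b := by
      intro b hb
      simp only [hB, hL, hH, Finset.mem_filter, Finset.mem_univ, true_and] at hb
      have hp : π.par b = 0 := by
        rcases π.par_cases b with hp | hp
        · exact hp
        · have := (hbound b).2 hp; omega
      exact ⟨hb.1.1, hb.1.2, hp, ((hbound b).1 hp).2.2 hb.2⟩
    refine Finset.card_le_card_of_forall_subsingleton (fun b z =>
      (¬ I.Nested z ∧ π.Reach z b) ∨
        (I.Nested z ∧ ∃ v, π.Reach v b ∧ v ∉ O ∧ I.Forces I.pred z v)) ?_ ?_
    · intro b hb
      obtain ⟨hbN, hlast, hpar, halt⟩ := hBp b hb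
      by_cases hA : ∀ y, π.Reach y b → y ∈ π.A
      · obtain ⟨z, v, hz, hv⟩ :=
          π.exists_nested_of_alternating hw hcov hforce hlast hbN hpar halt hA
        exact ⟨z, by simp [hN, hz], Or.inr ⟨hz, v, hv⟩⟩
      · push Not at hA
        obtain ⟨y, hy, hyA⟩ := hA
        have hyN := π.not_nested_of_reach hy hbN
        exact ⟨y, by simp [hH, hyN, hyA], Or.inl ⟨hyN, hy⟩⟩
    · rintro z - b ⟨hb, hzb⟩ b' ⟨hb', hzb'⟩
      have huniq : ∀ y, π.Reach y b → π.Reach y b' → b = b' := by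
        intro y h h'
        rcases π.reach_total h h' with h1 | h1
        · exact (π.eq_of_reach_of_last (hBp b hb).2.1 h1).symm
        · exact π.eq_of_reach_of_last (hBp b' hb').2.1 h1
      rcases hzb with ⟨h1, h2⟩ | ⟨h1, v, h2, h3, h4⟩ <;>
        rcases hzb' with ⟨h1', h2'⟩ | ⟨h1', v', h2', h3', h4'⟩
      · exact huniq z h2 h2'
      · exact absurd h1' h1
      · exact absurd h1 h1'
      · have := Input.eq_of_forces hcov h4 h4' h3 h3'
        subst this
        exact huniq v h2 h2'
  have hNO : N ⊆ O := by
    intro v hv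
    obtain ⟨u, hu⟩ := (Finset.mem_filter.mp hv).2.forced hw
    exact hforce u v hu
  have hOc : N.card + (H ∩ O).card ≤ O.card := by
    rw [← Finset.card_union_of_disjoint]
    · exact Finset.card_le_card (Finset.union_subset hNO Finset.inter_subset_right)
    · rw [Finset.disjoint_left]
      intro v hv hv'
      simp only [hN, hH, Finset.mem_inter, Finset.mem_filter, Finset.mem_univ, true_and] at hv hv'
      exact hv'.1 hv
  have hAc : π.A.card ≤ N.card + (H ∩ π.A).card := by
    have : π.A ⊆ N ∪ (H ∩ π.A) := by
      intro v hv
      by_cases h : I.Nested v <;> simp [hN, hH, h, hv]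
    exact (Finset.card_le_card this).trans (Finset.card_union_le _ _)
  have hHc := Finset.card_inter_add_card_sdiff H π.A
  have hU := Finset.card_union_le (H \ π.A) N
  omega

end Plan

/-! ### Total correctness with time bounds -/

/-- Started in `s`, the program halts within `T` steps in a state with property `Q`. -/
def Runs (I : Input n) (w : Fin n → ℝ) (p : Program) (T : ℕ) (s : State n)
    (Q : State n → Prop) : Prop :=
  ∃ t s', Exec I w p s t s' ∧ t ≤ T ∧ Q s'

theorem Runs.mono {p : Program} {T T' : ℕ} {s : State n} {Q Q' : State n → Prop}
    (h : Runs I w p T s Q) (hT : T ≤ T') (hQ : ∀ s, Q s → Q' s) : Runs I w p T' s Q' := by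
  obtain ⟨t, s', h1, h2, h3⟩ := h
  exact ⟨t, s', h1, h2.trans hT, hQ s' h3⟩

theorem Runs.seq {p q : Program} {T₁ T₂ : ℕ} {s : State n} {Q R : State n → Prop}
    (h₁ : Runs I w p T₁ s Q) (h₂ : ∀ s', Q s' → Runs I w q T₂ s' R) :
    Runs I w (Program.seq p q) (T₁ + T₂) s R := by
  obtain ⟨t₁, s₁, e₁, l₁, hQ⟩ := h₁
  obtain ⟨t₂, s₂, e₂, l₂, hR⟩ := h₂ s₁ hQ
  exact ⟨_, s₂, e₁.seq e₂, add_le_add l₁ l₂, hR⟩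

theorem runs_assign {i j e : NatExpr} {s : State n} {Q : State n → Prop}
    (h : Q (s.write (i.eval s) (j.eval s) (e.eval s))) :
    Runs I w (Program.assign i j e) 1 s Q :=
  ⟨1, _, Exec.assign i j e s, le_rfl, h⟩

theorem runs_query {e : NatExpr} {s : State n} {Q : State n → Prop}
    (h : Q (s.ask (e.eval s))) : Runs I w (Program.query e) 1 s Q :=
  ⟨1, _, Exec.query e s, le_rfl, h⟩

theorem runs_cond {b : Test} {p : Program} {T : ℕ} {s : State n} {Q : State n → Prop}
    (hp : b.Holds I w s → Runs I w p (T + 1) s Q) (hn : ¬ b.Holds I w s → Q s) :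
    Runs I w (Program.cond b p Program.nop) (T + 2) s Q := by
  by_cases hb : b.Holds I w s
  · obtain ⟨t, s', h1, h2, h3⟩ := hp hb
    exact ⟨1 + t, s', Exec.condTrue hb h1, by omega, h3⟩
  · exact ⟨1 + 1, s, Exec.condFalse hb (Exec.nop s), by omega, hn hb⟩

@[simp] theorem write_mem_same (s : State n) (i j k : ℕ) :
    (s.write i j k).mem i = Function.update (s.mem i) j k := by
  simp [State.write]

theorem write_mem_of_ne (s : State n) {i r : ℕ} (j k : ℕ) (h : r ≠ i) :
    (s.write i j k).mem r = s.mem r := by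
  simp [State.write, h]

@[simp] theorem write_queries (s : State n) (i j k : ℕ) :
    (s.write i j k).queries = s.queries := rfl

/-! ### Loops -/

/-- The counter number `j`. -/
def counter (j : ℕ) : NatExpr := .cell (.const 0) (.const j)

/-- The entry number `e` of the row `r` of the memory. -/
def entry (r : ℕ) (e : NatExpr) : NatExpr := .cell (.const r) e

@[simp] theorem eval_counter (s : State n) (j : ℕ) : (counter j).eval s = s.mem 0 j := rfl

@[simp] theorem eval_entry (s : State n) (r : ℕ) (e : NatExpr) :
    (entry r e).eval s = s.mem r (e.eval s) := rfl

/-- Execute `p` with the counter `j` running from `0` to `n - 1`. -/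
def forLoop (j : ℕ) (p : Program) : Program :=
  .seq (.assign (.const 0) (.const j) (.const 0))
    (.loop (.natLe (.add (counter j) (.const 1)) .size)
      (.seq p (.assign (.const 0) (.const j) (.add (counter j) (.const 1)))))

theorem runs_forLoop {j : ℕ} {p : Program} {T : ℕ} {s : State n} (Inv : ℕ → State n → Prop)
    (hinit : Inv 0 (s.write 0 j 0))
    (hstep : ∀ k < n, ∀ s : State n, s.mem 0 j = k → Inv k s →
      Runs I w p T s fun s' => s'.mem 0 j = k ∧ Inv (k + 1) (s'.write 0 j (k + 1))) :
    Runs I w (forLoop j p) (2 + n * (T + 2)) s (Inv n) := by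
  have key : ∀ d k, k + d = n → ∀ s : State n, s.mem 0 j = k → Inv k s →
      Runs I w (.loop (.natLe (.add (counter j) (.const 1)) .size)
        (.seq p (.assign (.const 0) (.const j) (.add (counter j) (.const 1)))))
        (1 + d * (T + 2)) s (Inv n) := by
    intro d
    induction d with
    | zero =>
      intro k hk s hs hI
      have hkn : k = n := by omega
      refine ⟨1, s, Exec.loopStop ?_, by omega, hkn ▸ hI⟩
      simp only [Test.Holds, NatExpr.eval, eval_counter]
      omega
    | succ d ih =>
      intro k hk s hs hI
      obtain ⟨t, s₁, e₁, l₁, h₁, hI₁⟩ := hstep k (by omega) s hs hI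
      obtain ⟨t', s₂, e₂, l₂, hI₂⟩ := ih (k + 1) (by omega) (s₁.write 0 j (k + 1)) (by simp) hI₁
      have e₃ : Exec I w (.assign (.const 0) (.const j) (.add (counter j) (.const 1))) s₁ 1
          (s₁.write 0 j (k + 1)) := by
        have := Exec.assign (I := I) (w := w) (.const 0) (.const j)
          (.add (counter j) (.const 1)) s₁
        simpa only [NatExpr.eval, eval_counter, h₁] using this
      refine ⟨_, s₂, Exec.loopStep ?_ (e₁.seq e₃) e₂, ?_, hI₂⟩
      · simp only [Test.Holds, NatExpr.eval, eval_counter]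
        omega
      · have : (d + 1) * (T + 2) = d * (T + 2) + (T + 2) := by ring
        omega
  have h0 : Runs I w (.assign (.const 0) (.const j) (.const 0)) 1 s
      (fun s' => s'.mem 0 j = 0 ∧ Inv 0 s') :=
    runs_assign ⟨by simp [NatExpr.eval], hinit⟩
  exact (h0.seq fun s' hs' => key n 0 (by omega) s' hs'.1 hs'.2).mono (by omega) fun _ h => h

/-- Execute `act` for all pairs of values of the counters `0` and `1` that pass the test. -/
def scan (test : Test) (act : Program) : Program :=
  forLoop 0 (forLoop 1 (.cond test act .nop))

/-- Time bound for a scan with an action of at most two steps. -/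
def scanTime (n : ℕ) : ℕ := 2 + n * (2 + n * 5 + 2)

/-- `J a b` describes the state when all pairs before `(a, b)` in lexicographic order are done.
Counter `2` is preserved because outer loops use it. -/
theorem runs_scan {test : Test} {act : Program} {s₀ : State n} (J : ℕ → ℕ → State n → Prop)
    (hJ : ∀ a b s j x, J a b s → J a b (s.write 0 j x))
    (hinit : J 0 0 s₀)
    (hact : ∀ a b : Fin n, ∀ s : State n, s.mem 0 0 = a → s.mem 0 1 = b → J a b s →
      test.Holds I w s → Runs I w act 2 s fun s' => s'.mem 0 = s.mem 0 ∧ J a (b + 1) s')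
    (hskip : ∀ a b : Fin n, ∀ s : State n, s.mem 0 0 = a → s.mem 0 1 = b → J a b s →
      ¬ test.Holds I w s → J a (b + 1) s)
    (hnext : ∀ (a : ℕ) (s : State n), J a n s → J (a + 1) 0 s) :
    Runs I w (scan test act) (scanTime n) s₀ fun s => s.mem 0 2 = s₀.mem 0 2 ∧ J n 0 s := by
  refine (runs_forLoop (T := 2 + n * 5) (fun k s => s.mem 0 2 = s₀.mem 0 2 ∧ J k 0 s) ?_ ?_).mono
    (by simp [scanTime]) fun _ h => h
  · exact ⟨by simp, hJ _ _ _ _ _ hinit⟩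
  · intro a ha s hs ⟨hs2, hJs⟩
    refine (runs_forLoop (T := 3)
      (fun k s => s.mem 0 0 = a ∧ s.mem 0 2 = s₀.mem 0 2 ∧ J a k s) ?_ ?_).mono le_rfl ?_
    · exact ⟨by simp [hs], by simp [hs2], hJ _ _ _ _ _ hJs⟩
    · intro b hb s hs1 ⟨hs0, hs2, hJs⟩
      refine runs_cond (T := 1) (fun ht => ?_) fun ht => ?_
      · refine (hact ⟨a, ha⟩ ⟨b, hb⟩ s hs0 hs1 hJs ht).mono le_rfl ?_
        rintro s' ⟨h0, h1⟩
        refine ⟨by rw [h0, hs1], ?_, ?_, hJ _ _ _ _ _ h1⟩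
        · simp [h0, hs0]
        · simp [h0, hs2]
      · refine ⟨hs1, by simp [hs0], by simp [hs2], hJ _ _ _ _ _ ?_⟩
        exact hskip ⟨a, ha⟩ ⟨b, hb⟩ s hs0 hs1 hJs ht
    · rintro s' ⟨h0, h2, h3⟩
      exact ⟨h0, by simp [h2], hJ _ _ _ _ _ (hnext a s' h3)⟩

/-- The pairs that have been scanned when the counters have the values `a` and `b`. -/
def Scanned (a b : ℕ) (v u : Fin n) : Prop := (v : ℕ) < a ∨ (v : ℕ) = a ∧ (u : ℕ) < b

theorem not_scanned_zero (v u : Fin n) : ¬ Scanned 0 0 v u := by simp [Scanned]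

theorem scanned_end (v u : Fin n) : Scanned n 0 v u := Or.inl v.2

theorem scanned_next (a : ℕ) (v u : Fin n) : Scanned a n v u ↔ Scanned (a + 1) 0 v u := by
  have := u.2
  simp only [Scanned]
  omega

theorem scanned_succ (a b v u : Fin n) :
    Scanned (a : ℕ) (b + 1) v u ↔ Scanned (a : ℕ) b v u ∨ v = a ∧ u = b := by
  simp only [Scanned, Fin.ext_iff]
  omega

/-- The states agree except possibly for the counters, the row `r`, and the queries. -/
def AgreeOff (r : ℕ) (s₀ s : State n) : Prop := ∀ i, i ≠ 0 → i ≠ r → s.mem i = s₀.mem i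

theorem AgreeOff.refl (r : ℕ) (s : State n) : AgreeOff r s s := fun _ _ _ => rfl

theorem AgreeOff.write_counter {r : ℕ} {s₀ s : State n} (h : AgreeOff r s₀ s) (j x : ℕ) :
    AgreeOff r s₀ (s.write 0 j x) := fun i h0 hr => by
  rw [write_mem_of_ne _ _ _ h0, h i h0 hr]

theorem AgreeOff.write {r : ℕ} {s₀ s : State n} (h : AgreeOff r s₀ s) (j x : ℕ) :
    AgreeOff r s₀ (s.write r j x) := fun i h0 hr => by
  rw [write_mem_of_ne _ _ _ hr, h i h0 hr]

/-! ### Reading real numbers -/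

theorem eval_lower {e : NatExpr} {s : State n} {a : Fin n} (h : e.eval s = a) :
    (RealExpr.lower e).eval I w s = I.lower a := by
  simp [RealExpr.eval, h]

theorem eval_upper {e : NatExpr} {s : State n} {a : Fin n} (h : e.eval s = a) :
    (RealExpr.upper e).eval I w s = I.upper a := by
  simp [RealExpr.eval, h]

theorem eval_pred {e : NatExpr} {s : State n} {a : Fin n} (h : e.eval s = a) :
    (RealExpr.pred e).eval I w s = I.pred a := by
  simp [RealExpr.eval, h]

theorem eval_weight {e : NatExpr} {s : State n} {a : Fin n} (h : e.eval s = a)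
    (ha : a ∈ s.queries) : (RealExpr.weight e).eval I w s = w a := by
  simp [RealExpr.eval, h, ha]

/-! ### Queries -/

/-- Query the vertex in the counter `0` and record this in row `1`. -/
def askMark : Program := .seq (.query (counter 0)) (.assign (.const 1) (counter 0) (.const 1))

/-- No vertex has been queried twice, and row `1` marks the queried vertices. -/
def Marked (s : State n) : Prop :=
  s.queries.Nodup ∧ ∀ v : Fin n, s.mem 1 v = 0 ↔ v ∉ s.queries

theorem Marked.write {s : State n} (h : Marked s) {i : ℕ} (hi : 1 ≠ i) (j x : ℕ) :
    Marked (s.write i j x) := by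
  refine ⟨h.1, fun v => ?_⟩
  rw [write_mem_of_ne _ _ _ hi]
  exact h.2 v

theorem Marked.length_le {s : State n} (h : Marked s) : s.queries.length ≤ n := by
  have := h.1.length_le_card
  simpa using this

theorem runs_askMark {s : State n} (hs : Marked s) {a : Fin n} (ha : s.mem 0 0 = a)
    (haq : a ∉ s.queries) : Runs I w askMark 2 s fun s' => s'.mem 0 = s.mem 0 ∧ Marked s' ∧
      AgreeOff 1 s s' ∧ s'.queries = a :: s.queries := by
  have h1 : s.ask ((counter 0).eval s) = { s with queries := a :: s.queries } := by
    simp [State.ask, ha]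
  refine Runs.seq (T₁ := 1) (T₂ := 1) (Q := fun s' => s' = { s with queries := a :: s.queries })
    (runs_query h1) ?_
  rintro s' rfl
  refine runs_assign ?_
  simp only [NatExpr.eval, eval_counter, ha]
  refine ⟨write_mem_of_ne _ _ _ (by omega), ⟨?_, fun v => ?_⟩, ?_, rfl⟩
  · exact List.nodup_cons.mpr ⟨haq, hs.1⟩
  · by_cases hv : v = a
    · subst hv; simp
    · simp [hv, Function.update_of_ne (Fin.val_ne_of_ne hv), hs.2 v]
  · intro i _ hi
    rw [write_mem_of_ne _ _ _ hi]

/-- Query all unqueried vertices in the counter `0` that pass the test together with some vertex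
in the counter `1`. -/
def queryScan (test : Test) : Program :=
  scan (.both (.natLe (entry 1 (counter 0)) (.const 0)) test) askMark

theorem runs_queryScan {test : Test} {s₀ : State n} (K : Fin n → Fin n → Prop)
    (hs₀ : Marked s₀)
    (htest : ∀ a b : Fin n, ∀ s : State n, s.mem 0 0 = a → s.mem 0 1 = b → AgreeOff 1 s₀ s →
      (test.Holds I w s ↔ K a b)) :
    Runs I w (queryScan test) (scanTime n) s₀ fun s => Marked s ∧ AgreeOff 1 s₀ s ∧
      ∀ v, v ∈ s.queries ↔ v ∈ s₀.queries ∨ ∃ u, K v u := by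
  refine (runs_scan (fun a b s => Marked s ∧ AgreeOff 1 s₀ s ∧
      ∀ v, v ∈ s.queries ↔ v ∈ s₀.queries ∨ ∃ u, Scanned a b v u ∧ K v u)
      ?_ ?_ ?_ ?_ ?_).mono le_rfl ?_
  · rintro a b s j x ⟨h1, h2, h3⟩
    exact ⟨h1.write (by omega) j x, h2.write_counter j x, h3⟩
  · exact ⟨hs₀, AgreeOff.refl 1 s₀, fun v => by simp [not_scanned_zero]⟩
  · rintro a b s ha hb ⟨h1, h2, h3⟩ ⟨ht1, ht2⟩
    have haq : a ∉ s.queries := by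
      rw [← h1.2 a]
      simpa [Test.Holds, NatExpr.eval, ha] using ht1
    have hK := (htest a b s ha hb h2).mp ht2
    refine (runs_askMark h1 ha haq).mono le_rfl ?_
    rintro s' ⟨e0, e1, e2, e3⟩
    refine ⟨e0, e1, fun i h0 hi => (e2 i h0 hi).trans (h2 i h0 hi), fun v => ?_⟩
    rw [e3, List.mem_cons, h3]
    simp only [scanned_succ]
    constructor
    · rintro (rfl | h | ⟨u, hu, hvu⟩)
      · exact Or.inr ⟨b, Or.inr ⟨rfl, rfl⟩, hK⟩
      · exact Or.inl h
      · exact Or.inr ⟨u, Or.inl hu, hvu⟩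
    · rintro (h | ⟨u, hu | ⟨rfl, rfl⟩, hvu⟩)
      · exact Or.inr (Or.inl h)
      · exact Or.inr (Or.inr ⟨u, hu, hvu⟩)
      · exact Or.inl rfl
  · rintro a b s ha hb ⟨h1, h2, h3⟩ ht
    refine ⟨h1, h2, fun v => ?_⟩
    have hno : a ∈ s.queries ∨ ¬ K a b := by
      by_contra hno
      push Not at hno
      refine ht ⟨?_, (htest a b s ha hb h2).mpr hno.2⟩
      simpa [Test.Holds, NatExpr.eval, ha] using (h1.2 a).mpr hno.1
    constructor
    · intro h
      rcases (h3 v).mp h with h | ⟨u, hu, hvu⟩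
      · exact Or.inl h
      · exact Or.inr ⟨u, (scanned_succ a b v u).mpr (Or.inl hu), hvu⟩
    · rintro (h | ⟨u, hu, hvu⟩)
      · exact (h3 v).mpr (Or.inl h)
      · rcases (scanned_succ a b v u).mp hu with hu | ⟨rfl, rfl⟩
        · exact (h3 v).mpr (Or.inr ⟨u, hu, hvu⟩)
        · exact hno.resolve_right (not_not_intro hvu)
  · rintro a s ⟨h1, h2, h3⟩
    exact ⟨h1, h2, by simpa only [scanned_next] using h3⟩
  · rintro s ⟨-, h1, h2, h3⟩
    exact ⟨h1, h2, by simpa only [scanned_end, true_and] using h3⟩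

/-- The precise weight of the queried vertex in the counter `1` forces the unqueried vertex in the
counter `0`. -/
def forceTest : Test :=
  .both (.natLe (entry 1 (counter 0)) (.const 0))
    (.both (.natLe (.const 1) (entry 1 (counter 1)))
      (.both (.neg (.realLe (.weight (counter 1)) (.lower (counter 0))))
        (.neg (.realLe (.upper (counter 0)) (.weight (counter 1))))))

theorem forceTest_holds {s : State n} (hs : Marked s) {a b : Fin n} (ha : s.mem 0 0 = a)
    (hb : s.mem 0 1 = b) :
    forceTest.Holds I w s ↔ a ∉ s.queries ∧ b ∈ s.queries ∧ I.Forces w b a := by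
  have h1 : s.mem 1 a ≤ 0 ↔ a ∉ s.queries := by rw [← hs.2 a]; omega
  have h2 : 1 ≤ s.mem 1 b ↔ b ∈ s.queries := by
    rw [← not_iff_not, ← hs.2 b]; omega
  simp only [forceTest, Test.Holds, NatExpr.eval, eval_entry, eval_counter, ha, hb, h1, h2,
    Input.Forces]
  constructor
  · rintro ⟨haq, hbq, h⟩
    rw [eval_weight (a := b) (by simpa using hb) hbq, eval_lower (a := a) (by simpa using ha),
      eval_upper (a := a) (by simpa using ha), not_le, not_le] at h
    exact ⟨haq, hbq, fun e => haq (e ▸ hbq), h⟩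
  · rintro ⟨haq, hbq, _, h⟩
    rw [eval_weight (a := b) (by simpa using hb) hbq, eval_lower (a := a) (by simpa using ha),
      eval_upper (a := a) (by simpa using ha), not_le, not_le]
    exact ⟨haq, hbq, h⟩

/-- All vertices forced by queried vertices are queried. -/
def ForceClosed (I : Input n) (w : Fin n → ℝ) (q : List (Fin n)) : Prop :=
  ∀ u ∈ q, ∀ v, I.Forces w u v → v ∈ q

/-- A scan that queries nothing has tested all pairs against an unchanged query list and thereby
certifies closedness; otherwise the list grows. -/
theorem runs_forceScan {s₀ : State n} (hs₀ : Marked s₀) :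
    Runs I w (scan forceTest askMark) (scanTime n) s₀ fun s => s.mem 0 2 = s₀.mem 0 2 ∧
      Marked s ∧ AgreeOff 1 s₀ s ∧ s₀.queries ⊆ s.queries ∧
      (∀ v ∈ s.queries, v ∈ s₀.queries ∨ ∃ u, I.Forces w u v) ∧
      (ForceClosed I w s.queries ∨
        s₀.queries.length < s.queries.length ∧ ¬ ForceClosed I w s₀.queries) := by
  refine (runs_scan (fun a b s => Marked s ∧ AgreeOff 1 s₀ s ∧ s₀.queries ⊆ s.queries ∧
      (∀ v ∈ s.queries, v ∈ s₀.queries ∨ ∃ u, I.Forces w u v) ∧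
      ((s.queries = s₀.queries ∧ ∀ v u, Scanned a b v u → u ∈ s₀.queries → I.Forces w u v →
        v ∈ s₀.queries) ∨ s₀.queries.length < s.queries.length ∧
        ¬ ForceClosed I w s₀.queries)) ?_ ?_ ?_ ?_ ?_).mono le_rfl ?_
  · rintro a b s j x ⟨h1, h2, h3⟩
    exact ⟨h1.write (by omega) j x, h2.write_counter j x, h3⟩
  · exact ⟨hs₀, AgreeOff.refl 1 s₀, fun _ h => h, fun _ h => Or.inl h,
      Or.inl ⟨rfl, fun v u h => absurd h (not_scanned_zero v u)⟩⟩
  · rintro a b s ha hb ⟨h1, h2, h3, h4, h5⟩ ht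
    rw [forceTest_holds h1 ha hb] at ht
    refine (runs_askMark h1 ha ht.1).mono le_rfl ?_
    rintro s' ⟨e0, e1, e2, e3⟩
    refine ⟨e0, e1, fun i h0 hi => (e2 i h0 hi).trans (h2 i h0 hi), ?_, ?_, Or.inr ?_⟩
    · rw [e3]; exact fun v hv => List.mem_cons_of_mem _ (h3 hv)
    · rw [e3]
      intro v hv
      rcases List.mem_cons.mp hv with rfl | hv
      · exact Or.inr ⟨b, ht.2.2⟩
      · exact h4 v hv
    · rw [e3, List.length_cons]
      rcases h5 with h5 | h5
      · rw [h5.1] at ht ⊢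
        exact ⟨by omega, fun hc => ht.1 (hc b ht.2.1 a ht.2.2)⟩
      · exact ⟨by omega, h5.2⟩
  · rintro a b s ha hb ⟨h1, h2, h3, h4, h5⟩ ht
    rw [forceTest_holds h1 ha hb] at ht
    refine ⟨h1, h2, h3, h4, h5.imp_left fun ⟨h7, h6⟩ => ⟨h7, fun v u hvu hu hf => ?_⟩⟩
    rcases (scanned_succ a b v u).mp hvu with h | ⟨rfl, rfl⟩
    · exact h6 v u h hu hf
    · by_contra hv
      rw [h7] at ht
      exact ht ⟨hv, hu, hf⟩
  · rintro a s ⟨h1, h2, h3, h4, h5⟩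
    exact ⟨h1, h2, h3, h4, by simpa only [scanned_next] using h5⟩
  · rintro s ⟨h0, h1, h2, h3, h4, h5⟩
    refine ⟨h0, h1, h2, h3, h4, h5.imp_left fun ⟨h5, h6⟩ => ?_⟩
    rw [h5]
    exact fun u hu v hf => h6 v u (scanned_end v u) hu hf

/-- Query forced vertices until all vertices forced by queried vertices are queried. -/
def closure : Program := forLoop 2 (scan forceTest askMark)

theorem runs_closure {s₀ : State n} (hs₀ : Marked s₀) :
    Runs I w closure (2 + n * (scanTime n + 2)) s₀ fun s => Marked s ∧ AgreeOff 1 s₀ s ∧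
      s₀.queries ⊆ s.queries ∧ (∀ v ∈ s.queries, v ∈ s₀.queries ∨ ∃ u, I.Forces w u v) ∧
      ForceClosed I w s.queries := by
  refine (runs_forLoop (fun k s => Marked s ∧ AgreeOff 1 s₀ s ∧
      s₀.queries ⊆ s.queries ∧ (∀ v ∈ s.queries, v ∈ s₀.queries ∨ ∃ u, I.Forces w u v) ∧
      (ForceClosed I w s.queries ∨ k ≤ s.queries.length)) ?_ ?_).mono le_rfl ?_
  · exact ⟨hs₀.write (by omega) _ _, (AgreeOff.refl 1 s₀).write_counter _ _, fun _ h => h,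
      fun _ h => Or.inl h, Or.inr (Nat.zero_le _)⟩
  · rintro k hk s hs ⟨h1, h2, h3, h4, h5⟩
    refine (runs_forceScan h1).mono le_rfl ?_
    rintro s' ⟨e0, e1, e2, e3, e4, e5⟩
    refine ⟨e0.trans hs, e1.write (by omega) _ _, ?_, fun v hv => e3 (h3 hv), ?_, ?_⟩
    · exact fun i h0 hi => by
        rw [write_mem_of_ne _ _ _ h0, e2 i h0 hi, h2 i h0 hi]
    · intro v hv
      rcases e4 v hv with h | h
      · exact h4 v h
      · exact Or.inr h
    · rcases e5 with e5 | e5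
      · exact Or.inl e5
      · rcases h5 with h5 | h5
        · exact absurd h5 e5.2
        · exact Or.inr (by rw [write_queries]; omega)
  · rintro s ⟨h1, h2, h3, h4, h5⟩
    refine ⟨h1, h2, h3, h4, h5.elim id fun h5 => ?_⟩
    intro u _ v _
    -- After `n` rounds that each made progress, all vertices have been queried.
    have h6 : s.queries.toFinset = Finset.univ := by
      apply Finset.eq_univ_of_card
      rw [List.toFinset_card_of_nodup h1.1, Fintype.card_fin]
      exact le_antisymm h1.length_le h5
    have : v ∈ s.queries.toFinset := by rw [h6]; exact Finset.mem_univ v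
    exact List.mem_toFinset.mp this

/-! ### Tables -/

/-- Mark in row `r` the vertices that pass the test together with some vertex. -/
def flagScan (r : ℕ) (test : Test) : Program :=
  scan test (.assign (.const r) (counter 0) (.const 1))

theorem runs_flagScan {r : ℕ} (hr : r ≠ 0) {test : Test} {s₀ : State n}
    (K : Fin n → Fin n → Prop) (hs₀ : ∀ v : Fin n, s₀.mem r v = 0)
    (htest : ∀ a b : Fin n, ∀ s : State n, s.mem 0 0 = a → s.mem 0 1 = b →
      (test.Holds I w s ↔ K a b)) :
    Runs I w (flagScan r test) (scanTime n) s₀ fun s => s.queries = s₀.queries ∧ AgreeOff r s₀ s ∧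
      ∀ v : Fin n, s.mem r v = 0 ↔ ¬ ∃ u, K v u := by
  refine (runs_scan (fun a b s => s.queries = s₀.queries ∧ AgreeOff r s₀ s ∧
      ∀ v : Fin n, s.mem r v = 0 ↔ ¬ ∃ u, Scanned a b v u ∧ K v u) ?_ ?_ ?_ ?_ ?_).mono le_rfl ?_
  · rintro a b s j x ⟨h1, h2, h3⟩
    refine ⟨h1, h2.write_counter j x, ?_⟩
    rwa [write_mem_of_ne _ _ _ hr]
  · exact ⟨rfl, AgreeOff.refl r s₀, fun v => by simp [not_scanned_zero, hs₀ v]⟩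
  · rintro a b s ha hb ⟨h1, h2, h3⟩ ht
    rw [htest a b s ha hb] at ht
    refine (runs_assign ?_).mono (by omega) fun _ h => h
    simp only [NatExpr.eval, eval_counter, ha]
    refine ⟨write_mem_of_ne _ _ _ hr.symm, h1, h2.write _ _, fun v => ?_⟩
    by_cases hv : v = a
    · subst hv
      simp only [write_mem_same, Function.update_self, one_ne_zero, false_iff, not_not]
      exact ⟨b, (scanned_succ v b v b).mpr (Or.inr ⟨rfl, rfl⟩), ht⟩
    · rw [write_mem_same, Function.update_of_ne (Fin.val_ne_of_ne hv), h3 v]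
      simp [scanned_succ, hv]
  · rintro a b s ha hb ⟨h1, h2, h3⟩ ht
    rw [htest a b s ha hb] at ht
    refine ⟨h1, h2, fun v => ?_⟩
    rw [h3 v, not_iff_not]
    refine exists_congr fun u => ?_
    rw [scanned_succ]
    refine ⟨fun h => ⟨Or.inl h.1, h.2⟩, fun h => ⟨h.1.resolve_right ?_, h.2⟩⟩
    rintro ⟨rfl, rfl⟩
    exact ht h.2
  · rintro a s ⟨h1, h2, h3⟩
    exact ⟨h1, h2, by simpa only [scanned_next] using h3⟩
  · rintro s ⟨-, h1, h2, h3⟩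
    exact ⟨h1, h2, by simpa only [scanned_end, true_and] using h3⟩

/-- A row contains the pointers `ptr`; the entry `0` stands for no pointer, and `b + 1` for `b`. -/
def Encodes (row : ℕ → ℕ) (ptr : Fin n → Option (Fin n)) : Prop :=
  ∀ a : Fin n, row a = (ptr a).elim 0 fun b => (b : ℕ) + 1

/-- Write to row `r` pointers to vertices in the counter `1` with greatest lower limit among those
that pass the test. -/
def findPtr (r : ℕ) (test : Test) : Program :=
  scan (.both test (.neg (.both (.natLe (.const 1) (entry r (counter 0)))
      (.realLe (.lower (counter 1)) (.lower (.sub (entry r (counter 0)) (.const 1)))))))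
    (.assign (.const r) (counter 0) (.add (counter 1) (.const 1)))

theorem runs_findPtr {r : ℕ} (hr : r ≠ 0) {test : Test} {s₀ : State n}
    (K : Fin n → Fin n → Prop) (hs₀ : ∀ v : Fin n, s₀.mem r v = 0)
    (htest : ∀ a b : Fin n, ∀ s : State n, s.mem 0 0 = a → s.mem 0 1 = b → AgreeOff r s₀ s →
      (test.Holds I w s ↔ K a b)) :
    Runs I w (findPtr r test) (scanTime n) s₀ fun s => s.queries = s₀.queries ∧ AgreeOff r s₀ s ∧
      ∃ ptr, Encodes (s.mem r) ptr ∧ I.IsMaxPtr K ptr := by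
  refine (runs_scan (fun a b s => s.queries = s₀.queries ∧ AgreeOff r s₀ s ∧
      ∃ ptr, Encodes (s.mem r) ptr ∧
        I.IsMaxPtr (fun v u => Scanned a b v u ∧ K v u) ptr) ?_ ?_ ?_ ?_ ?_).mono le_rfl ?_
  · rintro a b s j x ⟨h1, h2, h3⟩
    refine ⟨h1, h2.write_counter j x, ?_⟩
    rwa [write_mem_of_ne _ _ _ hr]
  · refine ⟨rfl, AgreeOff.refl r s₀, fun _ => none, hs₀, fun a => ⟨fun _ b h => ?_, ?_⟩⟩
    · exact not_scanned_zero a b h.1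
    · rintro b ⟨⟩
  · rintro a b s ha hb ⟨h1, h2, ptr, h3, h4⟩ ⟨ht, ht'⟩
    rw [htest a b s ha hb h2] at ht
    refine (runs_assign ?_).mono (by omega) fun _ h => h
    simp only [NatExpr.eval, eval_counter, ha, hb]
    refine ⟨write_mem_of_ne _ _ _ hr.symm, h1, h2.write _ _, Function.update ptr a (some b),
      fun v => ?_, fun v => ?_⟩
    · by_cases hv : v = a
      · subst hv; simp
      · rw [write_mem_same, Function.update_of_ne (Fin.val_ne_of_ne hv), h3 v,
          Function.update_of_ne hv]
    · by_cases hv : v = a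
      · subst hv
        rw [Function.update_self]
        refine ⟨fun h => by simp at h, fun b' hb' => ?_⟩
        obtain rfl : b = b' := Option.some.inj hb'
        refine ⟨⟨(scanned_succ v b v b).mpr (Or.inr ⟨rfl, rfl⟩), ht⟩, fun u hu => ?_⟩
        rcases (scanned_succ v b v u).mp hu.1 with h | ⟨_, rfl⟩
        · cases hp : ptr v with
          | none => exact absurd ⟨h, hu.2⟩ ((h4 v).1 hp u)
          | some c =>
            have h5 := ((h4 v).2 c hp).2 u ⟨h, hu.2⟩
            have h6 : s.mem r v = c + 1 := by rw [h3 v, hp]; rfl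
            -- The test passed although a pointer `c` was present, so `b` has the greater lower
            -- limit.
            simp only [Test.Holds, NatExpr.eval, eval_entry, eval_counter, ha, h6, not_and,
              not_le] at ht'
            have h7 := ht' (by omega)
            rw [eval_lower (a := c) (by simp [NatExpr.eval, ha, h6]),
              eval_lower (a := b) (by simpa using hb)] at h7
            exact h5.trans h7.le
        · exact le_rfl
      · rw [Function.update_of_ne hv]
        simpa [scanned_succ, hv] using h4 v
  · rintro a b s ha hb ⟨h1, h2, ptr, h3, h4⟩ ht
    refine ⟨h1, h2, ptr, h3, fun v => ?_⟩
    by_cases hv : v = a ∧ K a b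
    · obtain ⟨rfl, hK⟩ := hv
      have ht' : 1 ≤ s.mem r v ∧ (RealExpr.lower (counter 1)).eval I w s ≤
          (RealExpr.lower (.sub (entry r (counter 0)) (.const 1))).eval I w s := by
        by_contra hno
        refine ht ⟨(htest v b s ha hb h2).mpr hK, ?_⟩
        simpa only [Test.Holds, NatExpr.eval, eval_entry, eval_counter, ha] using hno
      cases hp : ptr v with
      | none => rw [h3 v, hp] at ht'; simp at ht'
      | some c =>
        refine ⟨fun h => by simp at h, fun c' hc' => ?_⟩
        obtain rfl : c = c' := Option.some.inj hc'
        obtain ⟨h5, h6⟩ := (h4 v).2 c hp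
        refine ⟨⟨(scanned_succ v b v c).mpr (Or.inl h5.1), h5.2⟩, fun u hu => ?_⟩
        rcases (scanned_succ v b v u).mp hu.1 with h | ⟨_, rfl⟩
        · exact h6 u ⟨h, hu.2⟩
        · have h7 : s.mem r v = c + 1 := by rw [h3 v, hp]; rfl
          have h8 := ht'.2
          rwa [eval_lower (e := counter 1) (a := u) (by simpa using hb),
            eval_lower (a := c) (by simp [NatExpr.eval, ha, h7])] at h8
    · have : ∀ u, (Scanned (a : ℕ) (b + 1) v u ∧ K v u) ↔ (Scanned (a : ℕ) b v u ∧ K v u) := by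
        intro u
        rw [scanned_succ]
        refine ⟨fun h => ⟨h.1.resolve_right ?_, h.2⟩, fun h => ⟨Or.inl h.1, h.2⟩⟩
        rintro ⟨rfl, rfl⟩
        exact hv ⟨rfl, h.2⟩
      simpa only [this] using h4 v
  · rintro a s ⟨h1, h2, h3⟩
    exact ⟨h1, h2, by simpa only [scanned_next] using h3⟩
  · rintro s ⟨-, h1, h2, h3⟩
    exact ⟨h1, h2, by simpa only [scanned_end, true_and] using h3⟩

/-- Replace each entry of row `r` that has a pointer in row `p` by the image under `op` of the entry
the pointer leads to; `n` rounds. -/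
def propagate (r p : ℕ) (op : NatExpr → NatExpr) : Program :=
  forLoop 2 (forLoop 0 (.cond (.natLe (.const 1) (entry p (counter 0)))
    (.assign (.const r) (counter 0)
      (op (entry r (.sub (entry p (counter 0)) (.const 1))))) .nop))

/-- Entries of vertices with rank below `c` are final after `c` rounds, as each pointer leads to a
smaller rank; ranks are below `n`. Recomputing a final entry does not change it. -/
theorem runs_propagate {r p : ℕ} (hr : r ≠ 0) (hp : p ≠ 0) (hrp : p ≠ r)
    {opE : NatExpr → NatExpr} {op : ℕ → ℕ}
    (hop : ∀ (e : NatExpr) (s : State n), (opE e).eval s = op (e.eval s))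
    {s₀ : State n} {ptr : Fin n → Option (Fin n)} (hptr : Encodes (s₀.mem p) ptr)
    (rk : Fin n → ℕ) (hrk : ∀ a b, ptr a = some b → rk b < rk a) (hrkn : ∀ a, rk a < n)
    {base : Fin n → ℕ} (hbase : ∀ a : Fin n, s₀.mem r a = base a) :
    Runs I w (propagate r p opE) (2 + n * (2 + n * 4 + 2)) s₀ fun s =>
      s.queries = s₀.queries ∧ AgreeOff r s₀ s ∧
      IsPropagation ptr base op fun a => s.mem r a := by
  obtain ⟨f, hf⟩ := exists_recursive ptr rk hrk (fun a o => o.elim (base a) op)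
  have hf' : IsPropagation ptr base op f := by
    intro a
    rw [hf a]
    cases ptr a <;> rfl
  have hfn : ∀ a, ptr a = none → f a = base a := fun a h => by rw [hf' a, h]; rfl
  have hfs : ∀ a b, ptr a = some b → f a = op (f b) := fun a b h => by rw [hf' a, h]; rfl
  refine (runs_forLoop (T := 2 + n * 4) (fun c s => s.queries = s₀.queries ∧ AgreeOff r s₀ s ∧
    ∀ a : Fin n, rk a < c ∨ ptr a = none → s.mem r a = f a) ?_ ?_).mono le_rfl ?_
  · refine ⟨rfl, (AgreeOff.refl r s₀).write_counter _ _, fun a ha => ?_⟩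
    have ha := ha.resolve_left (Nat.not_lt_zero _)
    rw [write_mem_of_ne _ _ _ hr, hbase a, hfn a ha]
  · rintro c - s hs ⟨h1, h2, h3⟩
    -- The update is in place: during round `c`, the vertices of rank `c` become correct as they are
    -- visited.
    refine (runs_forLoop (T := 2) (fun k s => s.mem 0 2 = c ∧ s.queries = s₀.queries ∧
      AgreeOff r s₀ s ∧ ∀ a : Fin n, rk a < c ∨ (rk a = c ∧ (a : ℕ) < k) ∨ ptr a = none →
        s.mem r a = f a) ?_ ?_).mono le_rfl ?_
    · refine ⟨by simp [hs], h1, h2.write_counter _ _, fun a ha => ?_⟩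
      rw [write_mem_of_ne _ _ _ hr]
      exact h3 a (by simpa using ha)
    · rintro k hk s hs0 ⟨hs2, h1, h2, h3⟩
      have hrow : s.mem p k = (ptr ⟨k, hk⟩).elim 0 fun b => (b : ℕ) + 1 := by
        rw [h2 p hp hrp]; exact hptr ⟨k, hk⟩
      refine runs_cond (T := 0) (fun ht => ?_) fun ht => ?_
      · simp only [Test.Holds, NatExpr.eval, eval_entry, eval_counter, hs0] at ht
        cases hpk : ptr ⟨k, hk⟩ with
        | none => rw [hrow, hpk] at ht; simp at ht
        | some b =>
          rw [hpk] at hrow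
          simp only [Option.elim_some] at hrow
          refine runs_assign ?_
          simp only [NatExpr.eval, eval_counter, hop, eval_entry, hs0, hrow, Nat.add_sub_cancel]
          refine ⟨?_, ?_, h1, (h2.write _ _).write_counter _ _, fun a ha => ?_⟩
          · rw [write_mem_of_ne _ _ _ hr.symm, hs0]
          · rw [write_mem_same, Function.update_of_ne (by omega),
              write_mem_of_ne _ _ _ hr.symm, hs2]
          · rw [write_mem_of_ne _ _ _ hr, write_mem_same]
            by_cases hak : a = ⟨k, hk⟩
            · subst hak
              have hlt := hrk _ _ hpk
              rw [Function.update_self, h3 b, hfs _ _ hpk]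
              left
              rcases ha with h | h | h
              · omega
              · omega
              · rw [hpk] at h; cases h
            · have hne : (a : ℕ) ≠ k := fun h => hak (Fin.ext h)
              rw [Function.update_of_ne hne]
              refine h3 a (ha.imp_right (Or.imp_left fun h => ⟨h.1, by omega⟩))
      · refine ⟨hs0, by simp [hs2], h1, h2.write_counter _ _, fun a ha => ?_⟩
        rw [write_mem_of_ne _ _ _ hr]
        by_cases hak : a = ⟨k, hk⟩
        · subst hak
          refine h3 _ (Or.inr (Or.inr ?_))
          cases hpk : ptr ⟨k, hk⟩ with
          | none => rfl
          | some b =>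
            refine absurd ?_ ht
            simp only [Test.Holds, NatExpr.eval, eval_entry, eval_counter, hs0, hrow, hpk,
              Option.elim_some]
            omega
        · have hne : (a : ℕ) ≠ k := fun h => hak (Fin.ext h)
          refine h3 a (ha.imp_right (Or.imp_left fun h => ⟨h.1, by omega⟩))
    · rintro s ⟨h0, h1, h2, h3⟩
      refine ⟨h0, h1, h2.write_counter _ _, fun a ha => ?_⟩
      rw [write_mem_of_ne _ _ _ hr]
      refine h3 a ?_
      rcases ha with h | h
      · rcases Nat.lt_succ_iff_lt_or_eq.mp h with h | h
        · exact Or.inl h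
        · exact Or.inr (Or.inl ⟨h, a.2⟩)
      · exact Or.inr (Or.inr h)
  · rintro s ⟨h1, h2, h3⟩
    refine ⟨h1, h2, fun a => ?_⟩
    beta_reduce
    rw [h3 a (Or.inl (hrkn a)), hf' a]
    cases hpa : ptr a with
    | none => rfl
    | some b => simp only [Option.elim_some]; rw [h3 b (Or.inl (hrkn b))]

/-! ### The algorithm -/

/-- The expressions have equal values. -/
def eqTest (x y : NatExpr) : Test := .both (.natLe x y) (.natLe y x)

/-- The first real number is smaller. -/
def ltTest (x y : RealExpr) : Test := .neg (.realLe y x)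

/-- The vertex in the counter `1` forces the vertex in the counter `0` for the predicted weights. -/
def predTest : Test :=
  .both (.neg (eqTest (counter 1) (counter 0)))
    (.both (ltTest (.lower (counter 0)) (.pred (counter 1)))
      (ltTest (.pred (counter 1)) (.upper (counter 0))))

/-- The interval of the vertex in the counter `0` contains that of the vertex in the counter `1`. -/
def nestedTest : Test :=
  .both (.neg (eqTest (counter 1) (counter 0)))
    (.both (.realLe (.lower (counter 0)) (.lower (counter 1)))
      (.realLe (.upper (counter 1)) (.upper (counter 0))))

/-- The vertices in the counters have entry `0` in the row `r`, and the one in the counter `i` is a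
left neighbour of the one in the counter `j`. -/
def leftTest (r i j : ℕ) : Test :=
  .both (eqTest (entry r (counter 0)) (.const 0)) (.both (eqTest (entry r (counter 1)) (.const 0))
    (.both (ltTest (.lower (counter i)) (.lower (counter j)))
      (ltTest (.lower (counter j)) (.upper (counter i)))))

/-- The labels of the vertex in the counter `0` put it into the cover. -/
def chosenTest : Test :=
  .neg (.both (.neg (eqTest (entry 4 (counter 0)) (.const 1)))
    (.neg (.both (eqTest (entry 4 (counter 0)) (.const 2))
      (eqTest (entry 8 (counter 0)) (.const 1)))))

/-- The expression for `2 - v`. -/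
def coflipExpr (e : NatExpr) : NatExpr := .sub (.const 2) e

/-- The expression for `1 - v`. -/
def toggleExpr (e : NatExpr) : NatExpr := .sub (.const 1) e

/-- The expression for `flip v`. -/
def flipExpr (e : NatExpr) : NatExpr :=
  .add (.sub (.const 1) e) (.add (.sub e (.const 1)) (.sub e (.const 1)))

@[simp] theorem eqTest_holds {x y : NatExpr} {s : State n} :
    (eqTest x y).Holds I w s ↔ x.eval s = y.eval s := by
  simp only [eqTest, Test.Holds]
  omega

@[simp] theorem ltTest_holds {x y : RealExpr} {s : State n} :
    (ltTest x y).Holds I w s ↔ x.eval I w s < y.eval I w s := by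
  simp only [ltTest, Test.Holds, not_le]

theorem predTest_holds {s : State n} {a b : Fin n} (ha : s.mem 0 0 = a) (hb : s.mem 0 1 = b) :
    predTest.Holds I w s ↔ I.Forces I.pred b a := by
  simp only [predTest, Test.Holds, eqTest_holds, ltTest_holds, eval_counter, ha, hb, Input.Forces]
  rw [eval_lower (a := a) (by simpa using ha), eval_upper (a := a) (by simpa using ha),
    eval_pred (a := b) (by simpa using hb), ← Fin.ext_iff]

theorem nestedTest_holds {s : State n} {a b : Fin n} (ha : s.mem 0 0 = a) (hb : s.mem 0 1 = b) :
    nestedTest.Holds I w s ↔ b ≠ a ∧ I.lower a ≤ I.lower b ∧ I.upper b ≤ I.upper a := by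
  simp only [nestedTest, Test.Holds, eqTest_holds, eval_counter, ha, hb]
  rw [eval_lower (e := counter 0) (a := a) (by simpa using ha),
    eval_upper (e := counter 0) (a := a) (by simpa using ha),
    eval_lower (e := counter 1) (a := b) (by simpa using hb),
    eval_upper (e := counter 1) (a := b) (by simpa using hb), ← Fin.ext_iff]

theorem leftTest_holds {s : State n} {r i j : ℕ} {a b x y : Fin n} (ha : s.mem 0 0 = a)
    (hb : s.mem 0 1 = b) (hx : s.mem 0 i = x) (hy : s.mem 0 j = y) :
    (leftTest r i j).Holds I w s ↔ s.mem r a = 0 ∧ s.mem r b = 0 ∧ I.LeftOf x y := by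
  simp only [leftTest, Test.Holds, eqTest_holds, ltTest_holds, NatExpr.eval, eval_entry,
    eval_counter, ha, hb, Input.LeftOf]
  rw [eval_lower (e := counter i) (a := x) (by simpa using hx),
    eval_upper (e := counter i) (a := x) (by simpa using hx),
    eval_lower (e := counter j) (a := y) (by simpa using hy)]

theorem chosenTest_holds {s : State n} {a : Fin n} (ha : s.mem 0 0 = a) :
    chosenTest.Holds I w s ↔ s.mem 4 a = 1 ∨ s.mem 4 a = 2 ∧ s.mem 8 a = 1 := by
  simp only [chosenTest, Test.Holds, eqTest_holds, NatExpr.eval, eval_entry, eval_counter, ha]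
  tauto

/-- First query the vertices predicted to be mandatory and all vertices they force. Then label the
vertices and query the cover determined by the labels; finally query the forced vertices. -/
def algorithm : Program :=
  .seq (queryScan predTest) <| .seq (flagScan 2 nestedTest) <| .seq closure <|
  .seq (findPtr 3 (leftTest 2 1 0)) <| .seq (propagate 4 3 coflipExpr) <|
  .seq (findPtr 5 (leftTest 1 1 0)) <| .seq (propagate 4 5 flipExpr) <|
  .seq (findPtr 7 (leftTest 1 0 1)) <| .seq (propagate 8 7 toggleExpr) <|
  .seq (queryScan chosenTest) closure

/-- A time bound for the algorithm. -/
def algorithmTime (n : ℕ) : ℕ :=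
  6 * scanTime n + 3 * (2 + n * (2 + n * 4 + 2)) + 2 * (2 + n * (scanTime n + 2))

theorem marked_of_agreeOff {r : ℕ} (hr : r ≠ 1) {s s' : State n} (h : AgreeOff r s s')
    (hq : s'.queries = s.queries) (hs : Marked s) : Marked s' := by
  refine ⟨hq ▸ hs.1, fun v => ?_⟩
  rw [h 1 (by omega) hr.symm, hq]
  exact hs.2 v

theorem runs_algorithm (I : Input n) (w : Fin n → ℝ) :
    Runs I w algorithm (algorithmTime n) (State.init n) fun s =>
      s.queries.Nodup ∧ ∃ π : Plan I w, π.A = s.queries.toFinset := by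
  have h0 : Marked (State.init n) := ⟨List.nodup_nil, fun v => by simp [State.init]⟩
  refine Runs.mono (T := scanTime n + (scanTime n + ((2 + n * (scanTime n + 2)) + (scanTime n +
    ((2 + n * (2 + n * 4 + 2)) + (scanTime n + ((2 + n * (2 + n * 4 + 2)) + (scanTime n +
    ((2 + n * (2 + n * 4 + 2)) + (scanTime n + (2 + n * (scanTime n + 2)))))))))))) ?_
    (by unfold algorithmTime; omega) fun _ h => h
  refine (runs_queryScan (fun a b => I.Forces I.pred b a) h0
    fun a b s ha hb _ => predTest_holds ha hb).seq ?_
  rintro s₁ ⟨m₁, f₁, q₁⟩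
  have z₁ : ∀ r, r ≠ 0 → r ≠ 1 → ∀ v, s₁.mem r v = 0 := fun r h h' v => by rw [f₁ r h h']; rfl
  refine (runs_flagScan (r := 2) (by omega) _ (fun v => z₁ 2 (by omega) (by omega) v)
    fun a b s ha hb => nestedTest_holds ha hb).seq ?_
  rintro s₂ ⟨q₂, f₂, n₂⟩
  have m₂ := marked_of_agreeOff (by omega) f₂ q₂ m₁
  refine (runs_closure m₂).seq ?_
  rintro s₃ ⟨m₃, f₃, q₃, q₃', c₃⟩
  have n₃ : ∀ v : Fin n, s₃.mem 2 v = 0 ↔ ¬ I.Nested v := fun v => by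
    rw [f₃ 2 (by omega) (by omega)]; exact n₂ v
  have z₃ : ∀ r, r ≠ 0 → r ≠ 1 → r ≠ 2 → ∀ v, s₃.mem r v = 0 := fun r h h' h'' v => by
    rw [f₃ r h h', f₂ r h h'', z₁ r h h']
  refine (runs_findPtr (r := 3) (by omega)
    (fun a b => ¬ I.Nested a ∧ ¬ I.Nested b ∧ I.LeftOf b a)
    (fun v => z₃ 3 (by omega) (by omega) (by omega) v) fun a b s ha hb hs => ?_).seq ?_
  · rw [leftTest_holds ha hb hb ha, hs 2 (by omega) (by omega), n₃, n₃]
  rintro s₄ ⟨q₄, f₄, prev, e₄, hprev⟩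
  refine (runs_propagate (r := 4) (p := 3) (by omega) (by omega) (by omega)
    (opE := coflipExpr) (op := fun v => 2 - v) (fun _ _ => rfl) e₄ I.rank
    (fun a b h => Input.rank_lt_rank ((hprev a).2 b h).1.2.2.1) Input.rank_lt
    (base := fun _ => 0) (fun a => ?_)).seq ?_
  · rw [f₄ 4 (by omega) (by omega), z₃ 4 (by omega) (by omega) (by omega)]
  rintro s₅ ⟨q₅, f₅, hpar⟩
  have r1 : ∀ v : Fin n, s₅.mem 1 v = 0 ↔ v ∉ s₃.queries := fun v => by
    rw [f₅ 1 (by omega) (by omega), f₄ 1 (by omega) (by omega)]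
    exact m₃.2 v
  refine (runs_findPtr (r := 5) (by omega)
    (fun a b => a ∉ s₃.queries ∧ b ∉ s₃.queries ∧ I.LeftOf b a) (fun v => ?_)
    fun a b s ha hb hs => ?_).seq ?_
  · rw [f₅ 5 (by omega) (by omega), f₄ 5 (by omega) (by omega),
      z₃ 5 (by omega) (by omega) (by omega)]
  · rw [leftTest_holds ha hb hb ha, hs 1 (by omega) (by omega), r1, r1]
  rintro s₆ ⟨q₆, f₆, left, e₆, hleft⟩
  -- Row `4` still contains `par` and is overwritten by `g`: vertices without a left pointer keep
  -- their entry, which is the required initial value. `flip` uses only sums and truncated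
  -- differences, so `flipExpr` agrees with it definitionally.
  refine (runs_propagate (r := 4) (p := 5) (by omega) (by omega) (by omega)
    (opE := flipExpr) (op := flip) (fun _ _ => rfl) e₆ I.rank
    (fun a b h => Input.rank_lt_rank ((hleft a).2 b h).1.2.2.1) Input.rank_lt
    (base := fun a => s₅.mem 4 a) (fun a => ?_)).seq ?_
  · rw [f₆ 4 (by omega) (by omega)]
  rintro s₇ ⟨q₇, f₇, hg⟩
  refine (runs_findPtr (r := 7) (by omega)
    (fun a b => a ∉ s₃.queries ∧ b ∉ s₃.queries ∧ I.LeftOf a b) (fun v => ?_)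
    fun a b s ha hb hs => ?_).seq ?_
  · rw [f₇ 7 (by omega) (by omega), f₆ 7 (by omega) (by omega), f₅ 7 (by omega) (by omega),
      f₄ 7 (by omega) (by omega), z₃ 7 (by omega) (by omega) (by omega)]
  · rw [leftTest_holds ha hb ha hb, hs 1 (by omega) (by omega), f₇ 1 (by omega) (by omega),
      f₆ 1 (by omega) (by omega), r1, r1]
  rintro s₈ ⟨q₈, f₈, right, e₈, hright⟩
  refine (runs_propagate (r := 8) (p := 7) (by omega) (by omega) (by omega)
    (opE := toggleExpr) (op := fun v => 1 - v) (fun _ _ => rfl) e₈ I.corank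
    (fun a b h => Input.corank_lt_corank ((hright a).2 b h).1.2.2.1) Input.corank_lt
    (base := fun _ => 0) (fun a => ?_)).seq ?_
  · rw [f₈ 8 (by omega) (by omega), f₇ 8 (by omega) (by omega), f₆ 8 (by omega) (by omega),
      f₅ 8 (by omega) (by omega), f₄ 8 (by omega) (by omega),
      z₃ 8 (by omega) (by omega) (by omega)]
  rintro s₉ ⟨q₉, f₉, hh⟩
  have q₉₃ : s₉.queries = s₃.queries := by rw [q₉, q₈, q₇, q₆, q₅, q₄]
  have m₉ : Marked s₉ := by
    refine ⟨q₉₃ ▸ m₃.1, fun v => ?_⟩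
    rw [f₉ 1 (by omega) (by omega), f₈ 1 (by omega) (by omega), f₇ 1 (by omega) (by omega),
      f₆ 1 (by omega) (by omega), r1, q₉₃]
  have g₉ : s₉.mem 4 = s₇.mem 4 := by
    rw [f₉ 4 (by omega) (by omega), f₈ 4 (by omega) (by omega)]
  refine (runs_queryScan
    (fun a _ => s₇.mem 4 a = 1 ∨ s₇.mem 4 a = 2 ∧ s₉.mem 8 a = 1) m₉
    fun a b s ha hb hs => ?_).seq ?_
  · rw [chosenTest_holds ha, hs 4 (by omega) (by omega), hs 8 (by omega) (by omega), g₉]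
  rintro s₁₀ ⟨m₁₀, f₁₀, q₁₀⟩
  refine (runs_closure m₁₀).mono le_rfl ?_
  rintro s ⟨m, -, q, q', c⟩
  refine ⟨m.1, ⟨{
    D := s₃.queries.toFinset
    A := s.queries.toFinset
    prev := prev
    left := left
    right := right
    par := fun a => s₅.mem 4 a
    g := fun a => s₇.mem 4 a
    h := fun a => s₉.mem 8 a
    predicted_mem := fun v hv => ?_
    mem_D := fun v hv => ?_
    closed_D := fun u hu v h => ?_
    prev_spec := hprev
    left_spec := by simpa only [List.mem_toFinset] using hleft
    right_spec := by simpa only [List.mem_toFinset] using hright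
    par_spec := hpar
    g_spec := hg
    h_spec := hh
    D_sub := fun v hv => ?_
    cover_sub := fun v _ hv => ?_
    mem_A := fun v hv => ?_
    closed_A := fun u hu v h => ?_ }, rfl⟩⟩
  · rw [List.mem_toFinset]
    exact q₃ (q₂ ▸ (q₁ v).mpr (Or.inr hv))
  · rw [List.mem_toFinset] at hv
    refine (q₃' v hv).imp_left fun hv => ?_
    rw [q₂, q₁] at hv
    exact hv.resolve_left (by simp [State.init])
  · rw [List.mem_toFinset] at hu ⊢
    exact c₃ u hu v h
  · rw [List.mem_toFinset] at hv ⊢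
    exact q ((q₁₀ v).mpr (Or.inl (q₉₃ ▸ hv)))
  · rw [List.mem_toFinset]
    -- The test ignores the second counter, so any vertex is a witness.
    exact q ((q₁₀ v).mpr (Or.inr ⟨v, hv⟩))
  · rw [List.mem_toFinset] at hv ⊢
    rcases q' v hv with hv | hv
    · rcases (q₁₀ v).mp hv with hv | ⟨_, hv⟩
      · exact Or.inl (q₉₃ ▸ hv)
      · exact Or.inr (Or.inl hv)
    · exact Or.inr (Or.inr hv)
  · rw [List.mem_toFinset] at hu ⊢
    exact c u hu v h

/-! ### Polynomial running time and the final bounds -/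

/-- The time bound as a polynomial. -/
noncomputable def timePolynomial : Polynomial ℕ :=
  6 * (2 + .X * (2 + .X * 5 + 2)) + 3 * (2 + .X * (2 + .X * 4 + 2)) +
    2 * (2 + .X * ((2 + .X * (2 + .X * 5 + 2)) + 2))

theorem eval_timePolynomial (n : ℕ) : timePolynomial.eval n = algorithmTime n := by
  simp [timePolynomial, algorithmTime, scanTime]

theorem le_min_mul {q k o : ℕ} (h₁ : q ≤ o + k) (h₂ : q ≤ 2 * o) :
    (q : ℝ) ≤ min (1 + (k : ℝ) / (o : ℝ)) 2 * (o : ℝ) := by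
  rcases Nat.eq_zero_or_pos o with rfl | ho
  -- The value `k / 0 = 0` is irrelevant, since the product with `o = 0` vanishes.
  · have : q = 0 := by omega
    simp [this]
  · have ho' : (0 : ℝ) < o := by exact_mod_cast ho
    rw [min_mul_of_nonneg _ _ ho'.le, le_min_iff]
    constructor
    · rw [add_mul, one_mul, div_mul_cancel₀ _ ho'.ne']
      exact_mod_cast h₁
    · exact_mod_cast h₂

end UncertainSorting

theorem theorem4p2 :
    ∃ (A : UncertainSorting.Program) (p : Polynomial ℕ),
      ∀ (n : ℕ) (I : UncertainSorting.Input n) (w : Fin n → ℝ), I.IsRealization w →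
        ∃ (t : ℕ) (s : UncertainSorting.State n),
          UncertainSorting.Exec I w A (UncertainSorting.State.init n) t s ∧
          t ≤ p.eval n ∧
          I.Feasible w s.queries.toFinset ∧
          (∀ k ∈ ({I.errCount w, I.errMandatory w, I.errHop w} : Set ℕ),
            (s.queries.length : ℝ) ≤ min (1 + (k : ℝ) / (I.opt w : ℝ)) 2 * (I.opt w : ℝ)) ∧
          (w = I.pred → s.queries.length ≤ I.opt w) ∧
          s.queries.length ≤ 2 * I.opt w := by
  refine ⟨UncertainSorting.algorithm, UncertainSorting.timePolynomial, fun n I w hw => ?_⟩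
  obtain ⟨t, s, hexec, ht, hnodup, π, hπ⟩ := UncertainSorting.runs_algorithm I w
  obtain ⟨O, hO, hOc⟩ := I.exists_feasible_card_eq_opt w
  have hlen : s.queries.length = π.A.card := by
    rw [hπ, List.toFinset_card_of_nodup hnodup]
  have h1 := π.card_le_errCount hw hO
  have h2 := π.card_le_errMandatory hw hO
  have h3 := UncertainSorting.Input.errMandatory_le_errHop hw
  have h4 := π.card_le_two_mul hw hO
  rw [hOc, ← hlen] at h1 h2 h4
  refine ⟨t, s, hexec, by rwa [UncertainSorting.eval_timePolynomial], hπ ▸ π.feasible hw,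
    ?_, fun h => ?_, h4⟩
  · rintro k (rfl | rfl | rfl)
    · exact UncertainSorting.le_min_mul h1 h4
    · exact UncertainSorting.le_min_mul h2 h4
    · exact UncertainSorting.le_min_mul (by omega) h4
  · have : I.errCount w = 0 := by simp [UncertainSorting.Input.errCount, h]
    omega
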